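/- Let $L^2=L^2(0,1)$ (real-valued) with norm $\|\cdot\|$ and let $H^{r}=H^{r}(0,1)$ be the standard Sobolev spaces. For integers $n\ge 1$, $p\ge 0$ and $k\ge 0$ let $$S_{p,k,n}=\big\{f\in C^k([0,1]) : f|_{I_j} \text{ is a polynomial of degree at most } p,\ j=0,\dots,n-1\big\},\qquad I_j=\big[\tfrac jn,\tfrac{j+1}n\big),$$ regarded as a subspace of $L^2$, let $\Pi_{p,k,n}$ be the $L^2$ projection onto $S_{p,k,n}$, and let $C_{p,k,n}$ be the smallest real number such that $$\|f-\Pi_{p,k,n}f\|\le C_{p,k,n}\,\|\partial^{p+1}f\|\qquad\text{for all } f\in H^{p+1}.$$ **Theorem (IGA-FEM comparison).** Let $p\ge 3$ and let $n$ satisfy $$n\ge 7 \text{ if } p=3;\qquad n\ge 4 \text{ if } p\in\{4,5\};\qquad n\ge 3 \text{ if } 6\le p\le 37;\qquad n\ge 2 \text{ if } p\ge 38.$$ Put $m=(n-1)p+1$. Then $\dim S_{p,p-1,m}=\dim S_{p,0,n}=np+1$, the smallest constants $C_{p,p-1,m}$ and $C_{p,0,n}$ exist, and $$C_{p,p-1,m}<C_{p,0,n}.$$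 -/

import Mathlib

open MeasureTheory Set
open scoped ContDiff

namespace SplineApprox

/-- Lebesgue measure on the unit interval `(0, 1)`. -/
noncomputable abbrev unitMeasure : Measure ℝ := volume.restrict (Ioo (0 : ℝ) 1)

/-- The real Hilbert space `L²(0, 1)`; its norm is the `L²` norm. -/
abbrev L2 : Type := Lp ℝ 2 unitMeasure

/-- `v` is the weak derivative of order `j` of `u` on `(0, 1)`. -/
def IsWeakDeriv (j : ℕ) (u v : L2) : Prop :=
  ∀ φ : ℝ → ℝ, ContDiff ℝ ∞ φ → HasCompactSupport φ → tsupport φ ⊆ Ioo (0 : ℝ) 1 →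
    ∫ x in Ioo (0 : ℝ) 1, u x * iteratedDeriv j φ x
      = (-1) ^ j * ∫ x in Ioo (0 : ℝ) 1, v x * φ x

/-- The Sobolev space `H^r(0, 1)`: all weak derivatives of order at most `r` exist in `L²(0, 1)`. -/
def sobolev (r : ℕ) : Set L2 := {u | ∀ j ≤ r, ∃ v : L2, IsWeakDeriv j u v}

/-- `s` restricted to `[0, 1]` is a spline of degree `p` and smoothness `C^k` on `n` uniform
segments: it is in `C^k([0, 1])` and agrees with a polynomial of degree at most `p` on each
`[j/n, (j+1)/n)`, `j = 0, …, n - 1`. -/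
def IsSpline (p k n : ℕ) (s : ℝ → ℝ) : Prop :=
  ContDiffOn ℝ k s (Icc 0 1) ∧
    ∀ j < n, ∃ P : Polynomial ℝ, P.natDegree ≤ p ∧
      ∀ x ∈ Ico ((j : ℝ) / n) (((j : ℝ) + 1) / n), s x = P.eval x

/-- The spline space `S_{p,k,n}`, as a subspace of `L²(0, 1)`. -/
def splineSpace (p k n : ℕ) : Submodule ℝ L2 where
  carrier := {u | ∃ s : ℝ → ℝ, IsSpline p k n s ∧ u =ᵐ[unitMeasure] s}
  zero_mem' := ⟨0, ⟨contDiffOn_const, fun _ _ => ⟨0, by simp, by simp⟩⟩, Lp.coeFn_zero _ _ _⟩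
  add_mem' := by
    rintro u v ⟨s, ⟨hs, hs'⟩, hu⟩ ⟨t, ⟨ht, ht'⟩, hv⟩
    refine ⟨s + t, ⟨hs.add ht, fun j hj => ?_⟩, (Lp.coeFn_add u v).trans (hu.add hv)⟩
    obtain ⟨P, hP, hPs⟩ := hs' j hj
    obtain ⟨Q, hQ, hQt⟩ := ht' j hj
    exact ⟨P + Q, Polynomial.natDegree_add_le_of_degree_le hP hQ,
      fun x hx => by simp [hPs x hx, hQt x hx]⟩
  smul_mem' := by
    rintro c u ⟨s, ⟨hs, hs'⟩, hu⟩
    refine ⟨c • s, ⟨contDiffOn_const.smul hs, fun j hj => ?_⟩,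
      (Lp.coeFn_smul c u).trans (hu.const_smul c)⟩
    obtain ⟨P, hP, hPs⟩ := hs' j hj
    exact ⟨c • P, (Polynomial.natDegree_smul_le c P).trans hP,
      fun x hx => by simp [hPs x hx]⟩

/-- The monomial `x ^ i` on the segment `[j/n, (j+1)/n)`, extended by zero. -/
noncomputable def segmentMonomial (n j i : ℕ) : ℝ → ℝ :=
  (Ico ((j : ℝ) / n) (((j : ℝ) + 1) / n)).indicator fun x => x ^ i

theorem memLp_segmentMonomial (n j i : ℕ) : MemLp (segmentMonomial n j i) 2 unitMeasure := by
  refine MemLp.indicator measurableSet_Ico ?_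
  refine MemLp.of_bound (by fun_prop) 1 ?_
  filter_upwards [ae_restrict_mem measurableSet_Ioo] with x hx
  rw [norm_pow, Real.norm_of_nonneg hx.1.le]
  exact pow_le_one₀ hx.1.le hx.2.le

/-- Spline spaces are finite dimensional, so the orthogonal projections onto them exist. -/
instance finiteDimensional_splineSpace (p k n : ℕ) [NeZero n] :
    FiniteDimensional ℝ (splineSpace p k n) := by
  set e : ℕ × ℕ → L2 := fun q => (memLp_segmentMonomial n q.1 q.2).toLp with he
  set I : Finset (ℕ × ℕ) := Finset.range n ×ˢ Finset.range (p + 1)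
  have hfin : FiniteDimensional ℝ (Submodule.span ℝ (e '' (I : Set (ℕ × ℕ)))) :=
    FiniteDimensional.span_of_finite ℝ (I.finite_toSet.image e)
  refine Submodule.finiteDimensional_of_le (S₂ := Submodule.span ℝ (e '' (I : Set (ℕ × ℕ)))) ?_
  rintro u ⟨s, ⟨-, hs⟩, hu⟩
  choose! P hP hPs using hs
  have hsum : u = ∑ q ∈ I, (P q.1).coeff q.2 • e q := by
    apply Lp.ext
    have h1 : ∀ q ∈ I, ((P q.1).coeff q.2 • e q : L2) =ᵐ[unitMeasure]
        fun x => (P q.1).coeff q.2 * segmentMonomial n q.1 q.2 x := fun q _ => by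
      filter_upwards [Lp.coeFn_smul ((P q.1).coeff q.2) (e q),
        (memLp_segmentMonomial n q.1 q.2).coeFn_toLp] with x hx hx'
      rw [hx, Pi.smul_apply, hx', smul_eq_mul]
    have h2 : ∀ᵐ x ∂unitMeasure, ∀ q ∈ I, ((P q.1).coeff q.2 • e q : L2) x
        = (P q.1).coeff q.2 * segmentMonomial n q.1 q.2 x :=
      (ae_ball_iff I.countable_toSet).2 h1
    filter_upwards [hu, h2, Lp.coeFn_finsetSum I fun q => (P q.1).coeff q.2 • e q,
      ae_restrict_mem measurableSet_Ioo] with x hux hx hxs hx01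
    have hn : (0 : ℝ) < n := by exact_mod_cast Nat.pos_of_ne_zero (NeZero.ne n)
    rw [hux, hxs, Finset.sum_apply, Finset.sum_congr rfl hx, Finset.sum_product]
    have hnx : 0 ≤ (n : ℝ) * x := mul_nonneg hn.le hx01.1.le
    set j₀ := ⌊(n : ℝ) * x⌋₊ with hj₀
    have hj₀n : j₀ < n := (Nat.floor_lt hnx).2 (by nlinarith [hx01.2])
    have hmem : ∀ j : ℕ, x ∈ Ico ((j : ℝ) / n) (((j : ℝ) + 1) / n) ↔ j = j₀ := fun j => by
      rw [mem_Ico, div_le_iff₀ hn, lt_div_iff₀ hn, mul_comm x, eq_comm, hj₀,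
        Nat.floor_eq_iff hnx]
    rw [Finset.sum_eq_single_of_mem j₀ (Finset.mem_range.2 hj₀n)]
    · rw [hPs j₀ hj₀n x ((hmem j₀).2 rfl),
        Polynomial.eval_eq_sum_range' (Nat.lt_succ_of_le (hP j₀ hj₀n))]
      refine Finset.sum_congr rfl fun i _ => ?_
      rw [segmentMonomial, indicator_of_mem ((hmem j₀).2 rfl)]
    · intro j _ hj
      refine Finset.sum_eq_zero fun i _ => ?_
      rw [segmentMonomial, indicator_of_notMem (fun h => hj ((hmem j).1 h)), mul_zero]
  rw [hsum]
  exact Submodule.sum_mem _ fun q hq => Submodule.smul_mem _ _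
    (Submodule.subset_span (mem_image_of_mem e hq))

/-- The `L²` projection `Π_{p,k,n}` onto the spline space `S_{p,k,n}`. -/
noncomputable def splineProj (p k n : ℕ) [NeZero n] : L2 →L[ℝ] L2 :=
  (splineSpace p k n).starProjection

/-- The real numbers `c` such that `‖f - Π_{p,k,n} f‖ ≤ c ‖∂^{q+1} f‖` for all
`f ∈ H^{q+1}(0, 1)`. -/
def errorBounds (p k n q : ℕ) [NeZero n] : Set ℝ :=
  {c | ∀ f ∈ sobolev (q + 1), ∀ g : L2, IsWeakDeriv (q + 1) f g →
    ‖f - splineProj p k n f‖ ≤ c * ‖g‖}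

/-- The smallest constant `C_{p,k,n,q}` in the above error estimate. -/
noncomputable def approxConstOfOrder (p k n q : ℕ) [NeZero n] : ℝ := sInf (errorBounds p k n q)

/-- `C_{p,k,n} = C_{p,k,n,p}`. -/
noncomputable def approxConst (p k n : ℕ) [NeZero n] : ℝ := approxConstOfOrder p k n p

end SplineApprox

/-!
Let `K` be the Volterra operator `K u (x) = ∫₀ˣ u` on `L²(0, 1)`. Splines are iterated primitives:
writing `primitives S = ℝ + K S`, taking primitives raises the degree and the smoothness by one,
starting from discontinuous piecewise polynomials (`splineSpace_zero_eq_primitives`,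
`splineSpace_succ_eq_primitives`). As `K` is injective and `1` is not in its range, each step adds
one to the dimension, which gives both dimension formulas.

*Upper bound for smooth splines.* Integration by parts says `K + K* = 1 ⊗ 1` (`inner_volterra`), so
`K` is skew on functions of mean zero. For the projection onto piecewise constants, Wirtinger's
inequality on each segment gives, by duality, `‖(I - P) K g‖ ≤ ‖g‖ / (m π)`. If this holds for a
space `S` containing the constants, an Aubin–Nitsche argument
(`volterra_sub_starProjection_primitives_le`) gives
`‖(I - P_{primitives S}) K g‖ ≤ (m π)⁻¹ ‖(I - P_S) g‖`; in particular the same constant works for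
`primitives S`. A function in `H^{p+1}` is a `(p + 1)`-fold primitive of its weak derivative
(`isPrimitive_of_mem_sobolev`), so iterating yields `C_{p,p-1,m} ≤ (1 / (m π)) ^ (p + 1)`.

*Lower bound for continuous splines.* Testing with `x ^ (p + 1)` and dropping the continuity, the
error on each segment is at least that of the monic Legendre polynomial of degree `p + 1`
(`le_integral_sq`, from Rodrigues' formula). Summing over the segments gives
`C_{p,0,n} ^ 2 ≥ n ^ (-2 (p + 1)) ((p + 1)!) ^ 2 / ((2 p + 2)! (2 p + 3)!)`.

*Comparison.* Since `n / ((n - 1) p + 1)` decreases in `n`, only the smallest admissible `n` matters;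
three cases with `p ≤ 5` are numerical, and the families with `n = 3` and `n = 2` follow by induction
on `p` (`constantsCompare`). The minimal constants exist because the set of admissible constants is
closed, bounded below by zero, and nonempty by the upper bound.
-/

namespace SplineApprox

open scoped RealInnerProductSpace

/-! ### The Volterra operator -/

theorem intervalIntegrable_coe (u : L2) {a b : ℝ} (ha : a ∈ Icc (0 : ℝ) 1)
    (hb : b ∈ Icc (0 : ℝ) 1) : IntervalIntegrable u volume a b := by
  have h : IntervalIntegrable u volume 0 1 := by
    rw [intervalIntegrable_iff_integrableOn_Ioo_of_le zero_le_one]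
    exact (Lp.memLp u).integrable (by norm_num)
  exact h.mono_set (by rw [uIcc_of_le zero_le_one]; exact uIcc_subset_Icc ha hb)

theorem intervalIntegrable_sq_coe (u : L2) {a b : ℝ} (ha : a ∈ Icc (0 : ℝ) 1)
    (hb : b ∈ Icc (0 : ℝ) 1) : IntervalIntegrable (fun x => u x ^ 2) volume a b := by
  have h : IntervalIntegrable (fun x => u x ^ 2) volume 0 1 := by
    rw [intervalIntegrable_iff_integrableOn_Ioo_of_le zero_le_one]
    exact (Lp.memLp u).integrable_sq
  exact h.mono_set (by rw [uIcc_of_le zero_le_one]; exact uIcc_subset_Icc ha hb)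

theorem inner_eq_integral (u v : L2) : ⟪u, v⟫ = ∫ x in (0 : ℝ)..1, u x * v x := by
  rw [intervalIntegral.integral_of_le zero_le_one, integral_Ioc_eq_integral_Ioo, L2.inner_def]
  simp [mul_comm]

theorem norm_sq_eq_integral (u : L2) : ‖u‖ ^ 2 = ∫ x in (0 : ℝ)..1, u x ^ 2 := by
  rw [← real_inner_self_eq_norm_sq, inner_eq_integral]
  simp [sq]

/-- An interval integral over `(0, 1)` only depends on the class modulo `unitMeasure`-null sets. -/
theorem integral_congr_unitMeasure {f g : ℝ → ℝ} (h : f =ᵐ[unitMeasure] g) {a b : ℝ}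
    (ha : a ∈ Icc (0 : ℝ) 1) (hb : b ∈ Icc (0 : ℝ) 1) :
    ∫ x in a..b, f x = ∫ x in a..b, g x := by
  refine intervalIntegral.integral_congr_ae ?_
  have h' := (ae_restrict_iff' measurableSet_Ioo).1 h
  filter_upwards [h', compl_mem_ae_iff.2 (measure_singleton (μ := volume) (1 : ℝ))]
    with x hx hx1 hx2
  refine hx ⟨?_, lt_of_le_of_ne ?_ hx1⟩
  · exact (le_min ha.1 hb.1).trans_lt hx2.1
  · exact hx2.2.trans (max_le ha.2 hb.2)

theorem memLp_of_continuousOn {f : ℝ → ℝ} (hf : ContinuousOn f (Icc 0 1)) :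
    MemLp f 2 unitMeasure := by
  obtain ⟨C, hC⟩ := isCompact_Icc.exists_bound_of_continuousOn hf
  refine MemLp.of_bound ((hf.mono Ioo_subset_Icc_self).aestronglyMeasurable measurableSet_Ioo) C ?_
  filter_upwards [ae_restrict_mem measurableSet_Ioo] with x hx
  exact hC x (Ioo_subset_Icc_self hx)

/-- The primitive `x ↦ ∫₀ˣ f`. -/
noncomputable def prim (f : ℝ → ℝ) (x : ℝ) : ℝ := ∫ t in (0 : ℝ)..x, f t

theorem prim_congr {f g : ℝ → ℝ} (h : f =ᵐ[unitMeasure] g) {x : ℝ} (hx : x ∈ Icc (0 : ℝ) 1) :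
    prim f x = prim g x :=
  integral_congr_unitMeasure h (by simp) hx

theorem absolutelyContinuous_prim (u : L2) : AbsolutelyContinuousOnInterval (prim u) 0 1 :=
  (intervalIntegrable_coe u (by simp) (by simp)).absolutelyContinuousOnInterval_intervalIntegral
    (by simp)

theorem continuousOn_prim (u : L2) : ContinuousOn (prim u) (Icc 0 1) := by
  simpa [uIcc_of_le] using (absolutelyContinuous_prim u).continuousOn

theorem deriv_prim (u : L2) : deriv (prim u) =ᵐ[unitMeasure] u := by
  refine (ae_restrict_iff' measurableSet_Ioo).2 ?_
  filter_upwards [(intervalIntegrable_coe u (a := 0) (b := 1)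
    (by simp) (by simp)).ae_hasDerivAt_integral] with x hx hx01
  exact (hx (by simpa [uIcc_of_le] using Ioo_subset_Icc_self hx01) 0 (by simp)).deriv

/-- The Volterra operator `u ↦ ∫₀ˣ u` on `L²(0, 1)`. -/
noncomputable def volterra : L2 →ₗ[ℝ] L2 where
  toFun u := (memLp_of_continuousOn (continuousOn_prim u)).toLp
  map_add' u v := by
    apply Lp.ext
    refine (MemLp.coeFn_toLp _).trans ?_
    filter_upwards [Lp.coeFn_add ((memLp_of_continuousOn (continuousOn_prim u)).toLp)
      ((memLp_of_continuousOn (continuousOn_prim v)).toLp),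
      (memLp_of_continuousOn (continuousOn_prim u)).coeFn_toLp,
      (memLp_of_continuousOn (continuousOn_prim v)).coeFn_toLp,
      ae_restrict_mem measurableSet_Ioo] with x h1 h2 h3 hx
    rw [h1, Pi.add_apply, h2, h3, prim_congr (Lp.coeFn_add u v) (Ioo_subset_Icc_self hx)]
    exact intervalIntegral.integral_add (intervalIntegrable_coe u (by simp) (Ioo_subset_Icc_self hx))
      (intervalIntegrable_coe v (by simp) (Ioo_subset_Icc_self hx))
  map_smul' c u := by
    apply Lp.ext
    refine (MemLp.coeFn_toLp _).trans ?_
    filter_upwards [Lp.coeFn_smul c ((memLp_of_continuousOn (continuousOn_prim u)).toLp),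
      (memLp_of_continuousOn (continuousOn_prim u)).coeFn_toLp,
      ae_restrict_mem measurableSet_Ioo] with x h1 h2 hx
    rw [RingHom.id_apply, h1, Pi.smul_apply, h2, prim_congr (Lp.coeFn_smul c u)
      (Ioo_subset_Icc_self hx)]
    exact intervalIntegral.integral_smul c _

theorem coeFn_volterra (u : L2) : volterra u =ᵐ[unitMeasure] prim u :=
  (memLp_of_continuousOn (continuousOn_prim u)).coeFn_toLp

/-- The constant function `1` in `L²(0, 1)`. -/
noncomputable def one : L2 := (memLp_const (1 : ℝ)).toLp

theorem coeFn_one : one =ᵐ[unitMeasure] fun _ => (1 : ℝ) := MemLp.coeFn_toLp _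

theorem inner_one (u : L2) : ⟪one, u⟫ = prim u 1 := by
  rw [inner_eq_integral]
  refine integral_congr_unitMeasure ?_ (by simp) (by simp)
  filter_upwards [coeFn_one] with x hx
  rw [hx, one_mul]

theorem inner_one_one : ⟪one, one⟫ = (1 : ℝ) := by
  rw [inner_one, prim_congr coeFn_one (by simp)]
  simp [prim]

/-- The symmetric part of the Volterra operator has rank one: integration by parts. -/
theorem inner_volterra (u v : L2) :
    ⟪volterra u, v⟫ = ⟪one, u⟫ * ⟪one, v⟫ - ⟪u, volterra v⟫ := by
  have h := (absolutelyContinuous_prim u).integral_mul_deriv_eq_deriv_mul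
    (absolutelyContinuous_prim v)
  have h1 : ∫ x in (0 : ℝ)..1, prim u x * deriv (prim v) x = ⟪volterra u, v⟫ := by
    rw [inner_eq_integral]
    refine integral_congr_unitMeasure ?_ (by simp) (by simp)
    filter_upwards [coeFn_volterra u, deriv_prim v] with x h1 h2
    rw [h1, h2]
  have h2 : ∫ x in (0 : ℝ)..1, deriv (prim u) x * prim v x = ⟪u, volterra v⟫ := by
    rw [inner_eq_integral]
    refine integral_congr_unitMeasure ?_ (by simp) (by simp)
    filter_upwards [coeFn_volterra v, deriv_prim u] with x h1 h2
    rw [h1, h2]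
  rw [← h1, ← h2, h, inner_one, inner_one]
  simp [prim]

theorem eqOn_of_ae_eq {f g : ℝ → ℝ} (hf : ContinuousOn f (Icc 0 1)) (hg : ContinuousOn g (Icc 0 1))
    (h : f =ᵐ[unitMeasure] g) : EqOn f g (Icc 0 1) := by
  have h1 : EqOn f g (Ioo 0 1) :=
    Measure.eqOn_open_of_ae_eq h isOpen_Ioo (hf.mono Ioo_subset_Icc_self)
      (hg.mono Ioo_subset_Icc_self)
  exact h1.of_subset_closure hf hg Ioo_subset_Icc_self (by rw [closure_Ioo (by norm_num)])

/-- A primitive starting from zero is constant only if it comes from the zero function. -/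
theorem eq_of_prim_eq_const {u : L2} {c : ℝ} (h : prim u =ᵐ[unitMeasure] fun _ => c) :
    u = 0 ∧ c = 0 := by
  have h1 := eqOn_of_ae_eq (continuousOn_prim u) continuousOn_const h
  have hc : c = 0 := by
    have h0 := h1 (show (0 : ℝ) ∈ Icc (0 : ℝ) 1 by simp)
    simpa [prim] using h0.symm
  refine ⟨Lp.ext ?_, hc⟩
  filter_upwards [deriv_prim u, ae_restrict_mem measurableSet_Ioo,
    Lp.coeFn_zero ℝ 2 unitMeasure] with x hx hx01 h0
  rw [← hx, h0]
  have : prim u =ᶠ[nhds x] fun _ => c := by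
    filter_upwards [Ioo_mem_nhds hx01.1 hx01.2] with y hy
    exact h1 (Ioo_subset_Icc_self hy)
  rw [this.deriv_eq]
  simp

theorem volterra_injective : Function.Injective volterra := by
  rw [injective_iff_map_eq_zero]
  intro u hu
  refine (eq_of_prim_eq_const (c := 0) ?_).1
  filter_upwards [coeFn_volterra u, Lp.coeFn_zero ℝ 2 unitMeasure] with x h1 h2
  rw [← h1, hu, h2]
  rfl

theorem one_notMem_range_volterra : one ∉ LinearMap.range volterra := by
  rintro ⟨u, hu⟩
  refine one_ne_zero (α := ℝ) (eq_of_prim_eq_const (u := u) (c := 1) ?_).2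
  filter_upwards [coeFn_volterra u, coeFn_one] with x h1 h2
  rw [← h1, hu, h2]

/-! ### The sharp Wirtinger inequality -/

/-- Wirtinger's inequality with a non-optimal constant `κ < π / (b - a)`, by Jacobi's substitution:
`w' ^ 2 - κ ^ 2 w ^ 2` differs from `(w' + w θ) ^ 2` by the derivative of `w ^ 2 θ`, where
`θ = κ tan (κ (x - c))` solves `θ' = κ ^ 2 + θ ^ 2` and has no singularity on `[a, b]`. -/
theorem wirtinger_aux {w : ℝ → ℝ} {a b κ : ℝ} (hab : a < b) (hκ : 0 < κ)
    (hκ' : κ * (b - a) < Real.pi) (hw : AbsolutelyContinuousOnInterval w a b)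
    (hd : IntervalIntegrable (fun x => deriv w x ^ 2) volume a b) (ha : w a = 0) (hb : w b = 0) :
    κ ^ 2 * ∫ x in a..b, w x ^ 2 ≤ ∫ x in a..b, deriv w x ^ 2 := by
  set c := (a + b) / 2 with hc
  have hcos : ∀ x ∈ uIcc a b, 0 < Real.cos (κ * (x - c)) := by
    intro x hx
    rw [uIcc_of_le hab.le] at hx
    have h1 : κ * (x - c) ≤ κ * (b - a) / 2 := by
      rw [mul_div_assoc]; exact mul_le_mul_of_nonneg_left (by linarith [hx.2]) hκ.le
    have h2 : -(κ * (b - a) / 2) ≤ κ * (x - c) := by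
      rw [mul_div_assoc, ← mul_neg]; exact mul_le_mul_of_nonneg_left (by linarith [hx.1]) hκ.le
    exact Real.cos_pos_of_mem_Ioo ⟨by linarith, by linarith⟩
  set θ : ℝ → ℝ := fun x => κ * Real.tan (κ * (x - c)) with hθ
  have hθd : ∀ x ∈ uIcc a b, HasDerivAt θ (κ ^ 2 + θ x ^ 2) x := by
    intro x hx
    have h1 := (((hasDerivAt_id x).sub_const c).const_mul κ)
    have h2 := ((Real.hasDerivAt_tan (hcos x hx).ne').comp x h1).const_mul κ
    refine h2.congr_deriv ?_
    have := Real.sin_sq_add_cos_sq (κ * (x - c))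
    have h0 := (hcos x hx).ne'
    change κ * (1 / Real.cos (κ * (x - c)) ^ 2 * (κ * 1))
      = κ ^ 2 + (κ * Real.tan (κ * (x - c))) ^ 2
    rw [Real.tan_eq_sin_div_cos]
    field_simp
    linear_combination -this
  have hθc : ContinuousOn θ (uIcc a b) := fun x hx => (hθd x hx).continuousAt.continuousWithinAt
  have hθac : AbsolutelyContinuousOnInterval θ a b := by
    refine ContDiffOn.absolutelyContinuousOnInterval ?_
    intro x hx
    have : ContDiffAt ℝ 1 θ x := by
      refine contDiffAt_const.mul ?_
      exact ContDiffAt.comp (g := Real.tan) (f := fun y => κ * (y - c)) x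
        (Real.contDiffAt_tan.2 (hcos x hx).ne') (by fun_prop)
    exact this.contDiffWithinAt
  have hwc := hw.continuousOn
  have hwd := hw.intervalIntegrable_deriv
  -- the total derivative of `w² θ`, which vanishes at both endpoints
  have key := (hw.fun_mul hw).integral_deriv_mul_eq_sub hθac
  rw [ha, hb] at key
  have key2 : ∫ x in a..b, (2 * (w x * θ x) * deriv w x + w x ^ 2 * (κ ^ 2 + θ x ^ 2)) = 0 := by
    rw [← sub_self (0 * 0 * θ a)]
    trans (0 * 0 * θ b - 0 * 0 * θ a)
    · rw [← key]
      refine intervalIntegral.integral_congr_ae ?_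
      filter_upwards [hw.ae_differentiableAt] with x hx hx'
      have hx' := uIoc_subset_uIcc hx'
      have h1 := (hx hx').hasDerivAt
      rw [(h1.fun_mul h1).deriv, (hθd x hx').deriv]
      ring
    · ring
  have i1 : IntervalIntegrable (fun x => 2 * (w x * θ x) * deriv w x) volume a b :=
    hwd.continuousOn_mul (by fun_prop)
  have i2 : IntervalIntegrable (fun x => w x ^ 2 * (κ ^ 2 + θ x ^ 2)) volume a b :=
    ContinuousOn.intervalIntegrable (by fun_prop)
  have i3 : IntervalIntegrable (fun x => κ ^ 2 * w x ^ 2) volume a b :=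
    ContinuousOn.intervalIntegrable (by fun_prop)
  have hpos : 0 ≤ ∫ x in a..b, (deriv w x + w x * θ x) ^ 2 :=
    intervalIntegral.integral_nonneg hab.le fun x _ => sq_nonneg _
  have heq : ∫ x in a..b, (deriv w x + w x * θ x) ^ 2
      = (∫ x in a..b, deriv w x ^ 2) + 0 - κ ^ 2 * ∫ x in a..b, w x ^ 2 := by
    rw [← key2, ← intervalIntegral.integral_const_mul, ← intervalIntegral.integral_add hd (i1.add i2),
      ← intervalIntegral.integral_sub (hd.add (i1.add i2)) i3]
    congr 1
    ext x
    ring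
  linarith

/-- The sharp Wirtinger inequality for functions vanishing at both endpoints. -/
theorem wirtinger {w : ℝ → ℝ} {a b : ℝ} (hab : a < b) (hw : AbsolutelyContinuousOnInterval w a b)
    (hd : IntervalIntegrable (fun x => deriv w x ^ 2) volume a b) (ha : w a = 0) (hb : w b = 0) :
    (Real.pi / (b - a)) ^ 2 * ∫ x in a..b, w x ^ 2 ≤ ∫ x in a..b, deriv w x ^ 2 := by
  have hba : 0 < b - a := sub_pos.2 hab
  have hΩ : 0 < Real.pi / (b - a) := div_pos Real.pi_pos hba
  have hcont : Filter.Tendsto (fun κ : ℝ => κ ^ 2 * ∫ x in a..b, w x ^ 2)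
      (nhdsWithin (Real.pi / (b - a)) (Iio (Real.pi / (b - a))))
      (nhds ((Real.pi / (b - a)) ^ 2 * ∫ x in a..b, w x ^ 2)) :=
    (Continuous.tendsto (by fun_prop) _).mono_left nhdsWithin_le_nhds
  refine le_of_tendsto hcont ?_
  filter_upwards [Ioo_mem_nhdsLT hΩ] with κ hκ
  exact wirtinger_aux hab hκ.1 ((lt_div_iff₀ hba).1 hκ.2) hw hd ha hb

/-- The function `r` has integral zero on each of the `n` segments. -/
def SegmentMeanZero (n : ℕ) (r : ℝ → ℝ) : Prop :=
  ∀ j < n, ∫ x in ((j : ℝ) / n)..(((j : ℝ) + 1) / n), r x = 0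

theorem node_mem_Icc {n j : ℕ} (hj : j ≤ n) : (j : ℝ) / n ∈ Icc (0 : ℝ) 1 := by
  refine ⟨by positivity, ?_⟩
  exact div_le_one_of_le₀ (by exact_mod_cast hj) (by positivity)

theorem node_succ_mem_Icc {n j : ℕ} (hj : j < n) : ((j : ℝ) + 1) / n ∈ Icc (0 : ℝ) 1 := by
  exact_mod_cast node_mem_Icc (Nat.succ_le_of_lt hj)

/-- Integrals over `(0, 1)` split into integrals over the segments. -/
theorem integral_eq_sum_segments {n : ℕ} [NeZero n] {f : ℝ → ℝ}
    (hf : IntervalIntegrable f volume 0 1) :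
    ∫ x in (0 : ℝ)..1, f x
      = ∑ j ∈ Finset.range n, ∫ x in ((j : ℝ) / n)..(((j : ℝ) + 1) / n), f x := by
  have hn : (n : ℝ) ≠ 0 := Nat.cast_ne_zero.2 (NeZero.ne n)
  have h := intervalIntegral.sum_integral_adjacent_intervals (f := f) (μ := volume)
    (a := fun j : ℕ => (j : ℝ) / n) (n := n) fun k hk => hf.mono_set (by
      rw [uIcc_of_le zero_le_one]
      exact uIcc_subset_Icc (node_mem_Icc hk.le) (node_mem_Icc hk))
  simp only [Nat.cast_zero, zero_div, div_self hn] at h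
  rw [← h]
  push_cast
  rfl

/-- Mean zero on every segment means that the primitive vanishes at every node. -/
theorem prim_node_eq_zero {n : ℕ} {r : L2} (hr : SegmentMeanZero n r) :
    ∀ j ≤ n, prim r ((j : ℝ) / n) = 0
  | 0, _ => by simp [prim]
  | j + 1, hj => by
    have h1 := prim_node_eq_zero hr j (by omega)
    have h2 := hr j (by omega)
    rw [prim] at h1 ⊢
    rw [← intervalIntegral.integral_add_adjacent_intervals
      (intervalIntegrable_coe r (by simp) (node_mem_Icc (n := n) (j := j) (by omega)))
      (intervalIntegrable_coe r (node_mem_Icc (n := n) (j := j) (by omega)) (node_mem_Icc hj)), h1]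
    push_cast
    rw [h2, add_zero]

/-- Wirtinger's inequality on each segment: if `r` has mean zero on the `n` segments, its primitive
vanishes at all the nodes. -/
theorem norm_volterra_le {n : ℕ} [NeZero n] {r : L2} (hr : SegmentMeanZero n r) :
    ‖volterra r‖ ≤ 1 / (n * Real.pi) * ‖r‖ := by
  have hn : (0 : ℝ) < n := Nat.cast_pos.2 (NeZero.pos n)
  have hnπ : 0 < n * Real.pi := mul_pos hn Real.pi_pos
  have hsq : (n * Real.pi) ^ 2 * ‖volterra r‖ ^ 2 ≤ ‖r‖ ^ 2 := by
    rw [norm_sq_eq_integral, norm_sq_eq_integral,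
      integral_eq_sum_segments (n := n) (intervalIntegrable_sq_coe _ (by simp) (by simp)),
      integral_eq_sum_segments (n := n) (intervalIntegrable_sq_coe _ (by simp) (by simp)),
      Finset.mul_sum]
    refine Finset.sum_le_sum fun j hj => ?_
    have hj := Finset.mem_range.1 hj
    have ha := node_mem_Icc hj.le
    have hb := node_succ_mem_Icc hj
    have hsub : uIcc ((j : ℝ) / n) (((j : ℝ) + 1) / n) ⊆ uIcc 0 1 := by
      rw [uIcc_of_le zero_le_one]
      exact uIcc_subset_Icc ha hb
    have hsq : (fun x => deriv (prim r) x ^ 2) =ᵐ[unitMeasure] fun x => r x ^ 2 := by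
      filter_upwards [deriv_prim r] with x hx
      rw [hx]
    have hint : IntervalIntegrable (fun x => deriv (prim r) x ^ 2) volume
        ((j : ℝ) / n) (((j : ℝ) + 1) / n) := by
      refine IntervalIntegrable.mono_set (a := 0) (b := 1) ?_ hsub
      rw [intervalIntegrable_iff_integrableOn_Ioo_of_le zero_le_one]
      exact (integrable_congr hsq).2 (Lp.memLp r).integrable_sq
    have h := wirtinger (by gcongr; linarith) ((absolutelyContinuous_prim r).mono hsub) hint
      (prim_node_eq_zero hr j hj.le) (by exact_mod_cast prim_node_eq_zero hr (j + 1) hj)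
    rw [integral_congr_unitMeasure hsq ha hb] at h
    rw [integral_congr_unitMeasure (g := fun x => prim r x ^ 2) _ ha hb]
    · have he : ((j : ℝ) + 1) / n - j / n = 1 / n := by ring
      rwa [he, show Real.pi / (1 / (n : ℝ)) = n * Real.pi by field_simp] at h
    · filter_upwards [coeFn_volterra r] with x hx
      rw [hx]
  rw [div_mul_eq_mul_div, one_mul, le_div_iff₀ hnπ]
  refine (sq_le_sq₀ (by positivity) (by positivity)).1 ?_
  linarith [mul_pow ‖volterra r‖ (n * Real.pi) 2]

/-! ### Discontinuous piecewise polynomials -/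

/-- `s` agrees with a polynomial of degree at most `p` on each of the `n` segments. -/
def IsPiecewisePoly (p n : ℕ) (s : ℝ → ℝ) : Prop :=
  ∀ j < n, ∃ P : Polynomial ℝ, P.natDegree ≤ p ∧
    ∀ x ∈ Ico ((j : ℝ) / n) (((j : ℝ) + 1) / n), s x = P.eval x

/-- The space of piecewise polynomials of degree at most `p` on `n` uniform segments, with no
continuity across the nodes. -/
def brokenSpace (p n : ℕ) : Submodule ℝ L2 where
  carrier := {u | ∃ s : ℝ → ℝ, IsPiecewisePoly p n s ∧ u =ᵐ[unitMeasure] s}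
  zero_mem' := ⟨0, fun _ _ => ⟨0, by simp, by simp⟩, Lp.coeFn_zero _ _ _⟩
  add_mem' := by
    rintro u v ⟨s, hs, hu⟩ ⟨t, ht, hv⟩
    refine ⟨s + t, fun j hj => ?_, (Lp.coeFn_add u v).trans (hu.add hv)⟩
    obtain ⟨P, hP, hPs⟩ := hs j hj
    obtain ⟨Q, hQ, hQt⟩ := ht j hj
    exact ⟨P + Q, Polynomial.natDegree_add_le_of_degree_le hP hQ,
      fun x hx => by simp [hPs x hx, hQt x hx]⟩
  smul_mem' := by
    rintro c u ⟨s, hs, hu⟩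
    refine ⟨c • s, fun j hj => ?_, (Lp.coeFn_smul c u).trans (hu.const_smul c)⟩
    obtain ⟨P, hP, hPs⟩ := hs j hj
    exact ⟨c • P, (Polynomial.natDegree_smul_le c P).trans hP, fun x hx => by simp [hPs x hx]⟩

/-- Every point of `[0, 1)` lies in exactly one of the `n` segments. -/
theorem exists_segment {n : ℕ} [NeZero n] {x : ℝ} (hx : x ∈ Ico (0 : ℝ) 1) :
    ∃ j₀ < n, ∀ j : ℕ, x ∈ Ico ((j : ℝ) / n) (((j : ℝ) + 1) / n) ↔ j = j₀ := by
  have hn : (0 : ℝ) < n := Nat.cast_pos.2 (NeZero.pos n)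
  have hnx : 0 ≤ (n : ℝ) * x := mul_nonneg hn.le hx.1
  refine ⟨⌊(n : ℝ) * x⌋₊, (Nat.floor_lt hnx).2 (by nlinarith [hx.2]), fun j => ?_⟩
  rw [mem_Ico, div_le_iff₀ hn, lt_div_iff₀ hn, mul_comm x, eq_comm (a := j),
    Nat.floor_eq_iff hnx]

/-- The segment monomials of degree at most `p`, as elements of `L²(0, 1)`. -/
noncomputable def brokenBasis (p n : ℕ) (q : Fin n × Fin (p + 1)) : L2 :=
  (memLp_segmentMonomial n q.1 q.2).toLp

theorem coeFn_sum_brokenBasis (p n : ℕ) (c : Fin n × Fin (p + 1) → ℝ) :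
    (∑ q, c q • brokenBasis p n q : L2) =ᵐ[unitMeasure]
      fun x => ∑ q, c q * segmentMonomial n q.1 q.2 x := by
  have h1 : ∀ q, (c q • brokenBasis p n q : L2) =ᵐ[unitMeasure]
      fun x => c q * segmentMonomial n q.1 q.2 x := fun q => by
    filter_upwards [Lp.coeFn_smul (c q) (brokenBasis p n q),
      (memLp_segmentMonomial n q.1 q.2).coeFn_toLp] with x hx hx'
    rw [hx, Pi.smul_apply, brokenBasis, hx', smul_eq_mul]
  filter_upwards [ae_all_iff.2 h1, Lp.coeFn_finsetSum Finset.univ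
    fun q => c q • brokenBasis p n q] with x hx hxs
  rw [hxs, Finset.sum_apply]
  exact Finset.sum_congr rfl fun q _ => hx q

theorem sum_segmentMonomial {p n : ℕ} (c : Fin n × Fin (p + 1) → ℝ) {x : ℝ} {j : Fin n}
    (hx : ∀ i : ℕ, x ∈ Ico ((i : ℝ) / n) (((i : ℝ) + 1) / n) ↔ i = j) :
    ∑ q, c q * segmentMonomial n q.1 q.2 x = ∑ i : Fin (p + 1), c (j, i) * x ^ (i : ℕ) := by
  rw [Fintype.sum_prod_type, Finset.sum_eq_single_of_mem j (Finset.mem_univ _)]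
  · refine Finset.sum_congr rfl fun i _ => ?_
    rw [segmentMonomial, indicator_of_mem ((hx j).2 rfl)]
  · intro k _ hk
    refine Finset.sum_eq_zero fun i _ => ?_
    rw [segmentMonomial, indicator_of_notMem (fun h => hk (Fin.ext ((hx k).1 h))), mul_zero]

theorem brokenBasis_mem (p n : ℕ) [NeZero n] (q : Fin n × Fin (p + 1)) :
    brokenBasis p n q ∈ brokenSpace p n := by
  have hn : (0 : ℝ) < n := Nat.cast_pos.2 (NeZero.pos n)
  refine ⟨segmentMonomial n q.1 q.2, fun j hj => ?_, (memLp_segmentMonomial n q.1 q.2).coeFn_toLp⟩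
  by_cases h : j = q.1
  · refine ⟨Polynomial.X ^ (q.2 : ℕ), ?_, fun x hx => ?_⟩
    · rw [Polynomial.natDegree_X_pow]; omega
    · rw [segmentMonomial, ← h, indicator_of_mem hx]; simp
  · refine ⟨0, by simp, fun x hx => ?_⟩
    obtain ⟨j₀, -, hj₀⟩ := exists_segment (n := n) (x := x)
      ⟨(node_mem_Icc hj.le).1.trans hx.1, hx.2.trans_le (node_succ_mem_Icc hj).2⟩
    rw [segmentMonomial, indicator_of_notMem, Polynomial.eval_zero]
    intro hx'
    exact h (((hj₀ j).1 hx).trans ((hj₀ q.1).1 hx').symm)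

/-- Arbitrary polynomials on the segments are combined by the segment monomials. -/
theorem exists_mem_span_brokenBasis {p n : ℕ} [NeZero n] {P : ℕ → Polynomial ℝ}
    (hP : ∀ j < n, (P j).natDegree ≤ p) :
    ∃ v ∈ Submodule.span ℝ (range (brokenBasis p n)), ∃ t : ℝ → ℝ, v =ᵐ[unitMeasure] t ∧
      ∀ j < n, ∀ x ∈ Ico ((j : ℝ) / n) (((j : ℝ) + 1) / n), t x = (P j).eval x := by
  refine ⟨∑ q : Fin n × Fin (p + 1), (P q.1).coeff q.2 • brokenBasis p n q,
    Submodule.sum_mem _ fun q _ => Submodule.smul_mem _ _ (Submodule.subset_span (mem_range_self q)),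
    _, coeFn_sum_brokenBasis p n fun q => (P q.1).coeff q.2, fun j hj x hx => ?_⟩
  obtain ⟨j₀, -, hseg⟩ := exists_segment (n := n) (x := x)
    ⟨(node_mem_Icc hj.le).1.trans hx.1, hx.2.trans_le (node_succ_mem_Icc hj).2⟩
  rw [← (hseg j).1 hx] at hseg
  rw [sum_segmentMonomial (j := ⟨j, hj⟩) _ hseg,
    Polynomial.eval_eq_sum_range' (Nat.lt_succ_of_le (hP j hj)), Finset.sum_range]

/-- The segment monomials span the discontinuous piecewise polynomials. -/
theorem brokenSpace_eq_span (p n : ℕ) [NeZero n] :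
    brokenSpace p n = Submodule.span ℝ (range (brokenBasis p n)) := by
  refine le_antisymm ?_ (Submodule.span_le.2 (range_subset_iff.2 (brokenBasis_mem p n)))
  rintro u ⟨s, hs, hu⟩
  choose! P hP hPs using hs
  obtain ⟨v, hv, t, hvt, ht⟩ := exists_mem_span_brokenBasis hP
  have huv : u = v := by
    apply Lp.ext
    filter_upwards [hu, hvt, ae_restrict_mem measurableSet_Ioo] with x hux hx hx01
    obtain ⟨j₀, hj₀, hseg⟩ := exists_segment (n := n) (Ioo_subset_Ico_self hx01)
    rw [hux, hx, hPs j₀ hj₀ x ((hseg j₀).2 rfl), ht j₀ hj₀ x ((hseg j₀).2 rfl)]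
  rwa [huv]

theorem segment_lt (n j : ℕ) [NeZero n] : (j : ℝ) / n < ((j : ℝ) + 1) / n := by
  have hn : (0 : ℝ) < n := Nat.cast_pos.2 (NeZero.pos n)
  gcongr
  linarith

theorem segment_subset {n j : ℕ} (hj : j < n) :
    Ioo ((j : ℝ) / n) (((j : ℝ) + 1) / n) ⊆ Ioo 0 1 :=
  Ioo_subset_Ioo (node_mem_Icc hj.le).1 (node_succ_mem_Icc hj).2

theorem linearIndependent_brokenBasis (p n : ℕ) [NeZero n] :
    LinearIndependent ℝ (brokenBasis p n) := by
  rw [Fintype.linearIndependent_iff]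
  rintro c hc ⟨j, i⟩
  set Q : Polynomial ℝ := ∑ i : Fin (p + 1), Polynomial.monomial (i : ℕ) (c (j, i)) with hQ
  have hQe : ∀ x, Q.eval x = ∑ i : Fin (p + 1), c (j, i) * x ^ (i : ℕ) := fun x => by
    simp [hQ, Polynomial.eval_finsetSum]
  have hsub := segment_subset j.2
  have hae : (fun x => Q.eval x) =ᵐ[volume.restrict (Ioo ((j : ℝ) / n) (((j : ℝ) + 1) / n))]
      fun _ => 0 := by
    have h0 : ∀ᵐ x ∂unitMeasure, ∑ q, c q * segmentMonomial n q.1 q.2 x = 0 := by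
      filter_upwards [coeFn_sum_brokenBasis p n c, Lp.coeFn_zero ℝ 2 unitMeasure] with x h1 h2
      rw [← h1, hc, h2]; rfl
    filter_upwards [ae_restrict_of_ae_restrict_of_subset hsub h0,
      ae_restrict_mem measurableSet_Ioo] with x hx hxj
    obtain ⟨j₀, hj₀, hseg⟩ := exists_segment (n := n) (Ioo_subset_Ico_self (hsub hxj))
    have hjj : (j : ℕ) = j₀ := (hseg j).1 (Ioo_subset_Ico_self hxj)
    rw [hQe, ← sum_segmentMonomial (j := j) c (by simpa [hjj] using hseg), hx]
  have hz : EqOn (fun x => Q.eval x) (fun _ => 0) (Ioo ((j : ℝ) / n) (((j : ℝ) + 1) / n)) :=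
    Measure.eqOn_open_of_ae_eq hae isOpen_Ioo (by fun_prop) (by fun_prop)
  have hQ0 : Q = 0 :=
    Polynomial.eq_zero_of_infinite_isRoot Q ((Ioo_infinite (segment_lt n j)).mono hz)
  have hco : Q.coeff i = c (j, i) := by
    simp [hQ, Polynomial.coeff_monomial, Fin.val_inj]
  rw [← hco, hQ0, Polynomial.coeff_zero]

instance finiteDimensional_brokenSpace (p n : ℕ) [NeZero n] :
    FiniteDimensional ℝ (brokenSpace p n) := by
  rw [brokenSpace_eq_span]
  exact FiniteDimensional.span_of_finite ℝ (finite_range _)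

theorem finrank_brokenSpace (p n : ℕ) [NeZero n] :
    Module.finrank ℝ (brokenSpace p n) = n * (p + 1) := by
  rw [brokenSpace_eq_span, finrank_span_eq_card (linearIndependent_brokenBasis p n)]
  simp

theorem one_mem_brokenSpace (p n : ℕ) : one ∈ brokenSpace p n :=
  ⟨fun _ => 1, fun _ _ => ⟨1, by simp, by simp⟩, coeFn_one⟩

theorem inner_brokenBasis_zero (r : L2) {n : ℕ} (j : Fin n) :
    ⟪r, brokenBasis 0 n (j, 0)⟫ = ∫ x in ((j : ℝ) / n)..(((j : ℝ) + 1) / n), r x := by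
  have ha := node_mem_Icc j.2.le
  have hb := node_succ_mem_Icc j.2
  have hab : (j : ℝ) / n ≤ ((j : ℝ) + 1) / n := by gcongr; linarith
  have h1 : ∫ x in Ioo (0 : ℝ) 1, r x * brokenBasis 0 n (j, 0) x
      = ∫ x, (Ico ((j : ℝ) / n) (((j : ℝ) + 1) / n)).indicator r x ∂unitMeasure := by
    refine integral_congr_ae ?_
    have hB : brokenBasis 0 n (j, 0) =ᵐ[unitMeasure] segmentMonomial n j 0 :=
      (memLp_segmentMonomial n j 0).coeFn_toLp
    filter_upwards [hB] with x hx
    rw [hx]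
    by_cases hxj : x ∈ Ico ((j : ℝ) / n) (((j : ℝ) + 1) / n)
    · simp [segmentMonomial, indicator_of_mem hxj]
    · simp [segmentMonomial, indicator_of_notMem hxj]
  rw [inner_eq_integral, intervalIntegral.integral_of_le zero_le_one,
    integral_Ioc_eq_integral_Ioo, h1, integral_indicator measurableSet_Ico,
    Measure.restrict_restrict measurableSet_Ico, intervalIntegral.integral_of_le hab]
  refine setIntegral_congr_set ?_
  have h2 := (ae_eq_refl (μ := volume) (Ico ((j : ℝ) / n) (((j : ℝ) + 1) / n))).inter
    (Ioo_ae_eq_Icc (μ := volume) (a := (0 : ℝ)) (b := 1))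
  rw [inter_eq_left.2 (Ico_subset_Icc_self.trans (Icc_subset_Icc ha.1 hb.2))] at h2
  exact h2.trans Ico_ae_eq_Ioc

/-! ### Error estimates for iterated primitives -/

theorem norm_sub_starProjection_le {S : Submodule ℝ L2} [S.HasOrthogonalProjection] (f : L2) {v : L2}
    (hv : v ∈ S) : ‖f - S.starProjection f‖ ≤ ‖f - v‖ := by
  rw [Submodule.starProjection_minimal]
  exact ciInf_le ⟨0, by rintro _ ⟨x, rfl⟩; exact norm_nonneg _⟩ (⟨v, hv⟩ : S)

theorem norm_sub_starProjection_le_norm {S : Submodule ℝ L2} [S.HasOrthogonalProjection] (f : L2) :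
    ‖f - S.starProjection f‖ ≤ ‖f‖ := by
  simpa using norm_sub_starProjection_le f S.zero_mem

theorem le_of_sq_le_mul {a b : ℝ} (ha : 0 ≤ a) (hb : 0 ≤ b) (h : a ^ 2 ≤ b * a) : a ≤ b := by
  rcases ha.eq_or_lt with rfl | ha
  · exact hb
  · exact le_of_mul_le_mul_right (by rwa [← sq]) ha

/-- The dual of Wirtinger's inequality: approximation of a primitive by piecewise constants. The
error `r` is orthogonal to the piecewise constants, so `‖r‖² = ⟪K g, r⟫ = -⟪g, K r⟫`. -/
theorem volterra_sub_starProjection_brokenSpace_le (n : ℕ) [NeZero n] (g : L2) :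
    ‖volterra g - (brokenSpace 0 n).starProjection (volterra g)‖ ≤ 1 / (n * Real.pi) * ‖g‖ := by
  set S := brokenSpace 0 n
  set r := volterra g - S.starProjection (volterra g) with hr
  have horth : ∀ w ∈ S, ⟪r, w⟫ = 0 := fun w hw => S.starProjection_inner_eq_zero _ _ hw
  have hmean : SegmentMeanZero n r := fun j hj => by
    rw [← inner_brokenBasis_zero r ⟨j, hj⟩]
    exact horth _ (brokenBasis_mem 0 n _)
  have hn : (0 : ℝ) < n := Nat.cast_pos.2 (NeZero.pos n)
  refine le_of_sq_le_mul (norm_nonneg _) (by positivity) ?_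
  have h1 : ‖r‖ ^ 2 = -⟪g, volterra r⟫ := by
    have h2 : ⟪r, r⟫ = ⟪volterra g, r⟫ := by
      nth_rewrite 2 [hr]
      rw [inner_sub_right, horth _ (S.starProjection_apply_mem _), sub_zero, real_inner_comm]
    rw [← real_inner_self_eq_norm_sq, h2, inner_volterra, real_inner_comm r one,
      horth _ (one_mem_brokenSpace 0 n)]
    ring
  calc ‖r‖ ^ 2 ≤ |⟪g, volterra r⟫| := by rw [h1]; exact neg_le_abs _
    _ ≤ ‖g‖ * ‖volterra r‖ := abs_real_inner_le_norm _ _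
    _ ≤ ‖g‖ * (1 / (n * Real.pi) * ‖r‖) := by gcongr; exact norm_volterra_le hmean
    _ = _ := by ring

/-- The space `ℝ + ∫ S` of all primitives of elements of `S`. -/
noncomputable def primitives (S : Submodule ℝ L2) : Submodule ℝ L2 :=
  Submodule.span ℝ {one} ⊔ S.map volterra

theorem mem_primitives {S : Submodule ℝ L2} {u : L2} :
    u ∈ primitives S ↔ ∃ c : ℝ, ∃ v ∈ S, u = c • one + volterra v := by
  simp only [primitives, Submodule.mem_sup, Submodule.mem_span_singleton, Submodule.mem_map]
  constructor
  · rintro ⟨_, ⟨c, rfl⟩, _, ⟨v, hv, rfl⟩, rfl⟩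
    exact ⟨c, v, hv, rfl⟩
  · rintro ⟨c, v, hv, rfl⟩
    exact ⟨_, ⟨c, rfl⟩, _, ⟨v, hv, rfl⟩, rfl⟩

theorem one_mem_primitives (S : Submodule ℝ L2) : one ∈ primitives S :=
  mem_primitives.2 ⟨1, 0, S.zero_mem, by simp⟩

instance finiteDimensional_primitives (S : Submodule ℝ L2) [FiniteDimensional ℝ S] :
    FiniteDimensional ℝ (primitives S) := by
  unfold primitives
  infer_instance

theorem finrank_primitives (S : Submodule ℝ L2) [FiniteDimensional ℝ S] :
    Module.finrank ℝ (primitives S) = Module.finrank ℝ S + 1 := by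
  have h := Submodule.finrank_sup_add_finrank_inf_eq (Submodule.span ℝ {one}) (S.map volterra)
  have hinf : Submodule.span ℝ {one} ⊓ S.map volterra = ⊥ := by
    rw [← disjoint_iff, disjoint_comm, Submodule.disjoint_span_singleton']
    · rintro ⟨v, -, hv⟩
      exact one_notMem_range_volterra ⟨v, hv⟩
    · intro h0
      simpa [h0] using inner_one_one
  have hone : one ≠ 0 := fun h0 => by simpa [h0] using inner_one_one
  rw [hinf, finrank_bot, add_zero, finrank_span_singleton hone,
    ← (Submodule.equivMapOfInjective volterra volterra_injective S).finrank_eq, add_comm 1] at h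
  exact h

/-- The Aubin–Nitsche duality argument: an error constant for `S` also serves for the primitives of
`S`, and there the error is controlled by that of approximating the derivative in `S`. -/
theorem volterra_sub_starProjection_primitives_le {S : Submodule ℝ L2} [FiniteDimensional ℝ S]
    (h1 : one ∈ S) {c : ℝ} (hc : 0 ≤ c)
    (hS : ∀ g, ‖volterra g - S.starProjection (volterra g)‖ ≤ c * ‖g‖) (g : L2) :
    ‖volterra g - (primitives S).starProjection (volterra g)‖ ≤ c * ‖g - S.starProjection g‖ := by
  set r := g - S.starProjection g with hr
  have horth : ∀ w ∈ S, ⟪r, w⟫ = 0 := fun w hw => S.starProjection_inner_eq_zero _ _ hw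
  have hr1 : ⟪one, r⟫ = 0 := by rw [real_inner_comm]; exact horth _ h1
  -- `e` is the error of a Ritz-type projection of `volterra g`
  set e := volterra r - ⟪one, volterra r⟫ • one with he
  have he1 : ⟪one, e⟫ = 0 := by
    rw [he, inner_sub_right, real_inner_smul_right, inner_one_one]
    ring
  have hle : ‖volterra g - (primitives S).starProjection (volterra g)‖ ≤ ‖e‖ := by
    have hv : ⟪one, volterra r⟫ • one + volterra (S.starProjection g) ∈ primitives S :=
      mem_primitives.2 ⟨_, _, S.starProjection_apply_mem g, rfl⟩
    refine (norm_sub_starProjection_le _ hv).trans_eq ?_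
    rw [he, hr, map_sub]
    congr 1
    abel
  refine hle.trans (le_of_sq_le_mul (norm_nonneg _) (by positivity) ?_)
  set d := volterra e - S.starProjection (volterra e) with hd
  have h2 : ‖e‖ ^ 2 = -⟪r, d⟫ := by
    have h3 : ⟪e, e⟫ = ⟪volterra r, e⟫ := by
      nth_rewrite 1 [he]
      rw [inner_sub_left, real_inner_smul_left, he1]
      ring
    rw [← real_inner_self_eq_norm_sq, h3, inner_volterra, hr1, hd, inner_sub_right r,
      horth _ (S.starProjection_apply_mem _)]
    ring
  calc ‖e‖ ^ 2 ≤ |⟪r, d⟫| := by rw [h2]; exact neg_le_abs _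
    _ ≤ ‖r‖ * ‖d‖ := abs_real_inner_le_norm _ _
    _ ≤ ‖r‖ * (c * ‖e‖) := by gcongr; exact hS e
    _ = _ := by ring

/-- Maximally smooth splines of degree `p`, built from piecewise constants by taking primitives. -/
noncomputable def smoothSpace (n : ℕ) : ℕ → Submodule ℝ L2
  | 0 => brokenSpace 0 n
  | p + 1 => primitives (smoothSpace n p)

instance finiteDimensional_smoothSpace (n : ℕ) [NeZero n] :
    (p : ℕ) → FiniteDimensional ℝ (smoothSpace n p)
  | 0 => finiteDimensional_brokenSpace 0 n
  | p + 1 =>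
    have := finiteDimensional_smoothSpace n p
    finiteDimensional_primitives (smoothSpace n p)

theorem one_mem_smoothSpace (n : ℕ) : (p : ℕ) → one ∈ smoothSpace n p
  | 0 => one_mem_brokenSpace 0 n
  | _ + 1 => one_mem_primitives _

theorem finrank_smoothSpace (n p : ℕ) [NeZero n] :
    Module.finrank ℝ (smoothSpace n p) = n + p := by
  induction p with
  | zero => exact (finrank_brokenSpace 0 n).trans (by ring)
  | succ p ih => rw [smoothSpace, finrank_primitives, ih, add_assoc]

/-- The constant `1 / (n π)` is inherited by all degrees. -/
theorem volterra_sub_starProjection_smoothSpace_le (n p : ℕ) [NeZero n] (g : L2) :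
    ‖volterra g - (smoothSpace n p).starProjection (volterra g)‖ ≤ 1 / (n * Real.pi) * ‖g‖ := by
  have hc : 0 ≤ 1 / (n * Real.pi) := by positivity
  induction p generalizing g with
  | zero => exact volterra_sub_starProjection_brokenSpace_le n g
  | succ p ih =>
    refine (volterra_sub_starProjection_primitives_le (one_mem_smoothSpace n p) hc ih g).trans ?_
    gcongr
    exact norm_sub_starProjection_le_norm g

/-- `f` is an `r`-fold primitive of `g`, with arbitrary constants of integration. -/
def IsPrimitive : ℕ → L2 → L2 → Prop
  | 0, f, g => f = g
  | r + 1, f, g => ∃ (c : ℝ) (h : L2), f = c • one + volterra h ∧ IsPrimitive r h g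

theorem sub_starProjection_add_smul_one {S : Submodule ℝ L2} [S.HasOrthogonalProjection]
    (h1 : one ∈ S) (c : ℝ) (u : L2) :
    (c • one + u) - S.starProjection (c • one + u) = u - S.starProjection u := by
  rw [map_add, Submodule.starProjection_eq_self_iff.2 (S.smul_mem c h1)]
  abel

/-- The error estimate for maximally smooth splines. -/
theorem sub_starProjection_smoothSpace_le {n p : ℕ} [NeZero n] {f g : L2}
    (h : IsPrimitive (p + 1) f g) :
    ‖f - (smoothSpace n p).starProjection f‖ ≤ (1 / (n * Real.pi)) ^ (p + 1) * ‖g‖ := by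
  have hc : 0 ≤ 1 / (n * Real.pi) := by positivity
  induction p generalizing f with
  | zero =>
    obtain ⟨c, h, rfl, rfl⟩ := h
    rw [sub_starProjection_add_smul_one (one_mem_smoothSpace n 0), zero_add, pow_one]
    exact volterra_sub_starProjection_smoothSpace_le n 0 h
  | succ p ih =>
    obtain ⟨c, h, rfl, hh⟩ := h
    rw [sub_starProjection_add_smul_one (one_mem_smoothSpace n _)]
    refine (volterra_sub_starProjection_primitives_le (one_mem_smoothSpace n p) hc
      (volterra_sub_starProjection_smoothSpace_le n p) h).trans ?_
    rw [pow_succ', mul_assoc]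
    gcongr
    exact ih hh

/-! ### Splines as iterated primitives of piecewise polynomials -/

theorem IsPiecewisePoly.derivWithin {p n : ℕ} [NeZero n] {s : ℝ → ℝ}
    (hs : IsPiecewisePoly (p + 1) n s) (hd : DifferentiableOn ℝ s (Icc 0 1)) :
    IsPiecewisePoly p n (derivWithin s (Icc 0 1)) := by
  intro j hj
  obtain ⟨P, hP, hPs⟩ := hs j hj
  refine ⟨P.derivative, (P.natDegree_derivative_le).trans (by omega), fun x hx => ?_⟩
  have hsub : Ico ((j : ℝ) / n) (((j : ℝ) + 1) / n) ⊆ Icc 0 1 :=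
    Ico_subset_Icc_self.trans
      (Icc_subset_Icc (node_mem_Icc hj.le).1 (node_succ_mem_Icc hj).2)
  have h1 := ((hd x (hsub hx)).hasDerivWithinAt).mono hsub
  have h2 := ((P.hasDerivAt x).hasDerivWithinAt (s := Ico ((j : ℝ) / n) (((j : ℝ) + 1) / n))).congr
    hPs (hPs x hx)
  exact (uniqueDiffOn_Ico _ _ x hx).eq_deriv _ h1 h2

theorem prim_derivWithin {s : ℝ → ℝ} (hs : ContDiffOn ℝ 1 s (Icc 0 1)) {x : ℝ}
    (hx : x ∈ Icc (0 : ℝ) 1) : prim (derivWithin s (Icc 0 1)) x = s x - s 0 := by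
  have hc : ContinuousOn (derivWithin s (Icc 0 1)) (Icc 0 1) :=
    hs.continuousOn_derivWithin (uniqueDiffOn_Icc one_pos) le_rfl
  have hsub : Icc 0 x ⊆ Icc (0 : ℝ) 1 := Icc_subset_Icc_right hx.2
  refine intervalIntegral.integral_eq_sub_of_hasDerivAt_of_le hx.1 (hs.continuousOn.mono hsub)
    (fun y hy => ?_) ?_
  · have hy' : y ∈ Ioo (0 : ℝ) 1 := ⟨hy.1, hy.2.trans_le hx.2⟩
    exact ((hs.differentiableOn one_ne_zero y (Ioo_subset_Icc_self hy')).hasDerivWithinAt).hasDerivAt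
      (Icc_mem_nhds hy'.1 hy'.2)
  · exact (hc.mono (by rwa [uIcc_of_le hx.1])).intervalIntegrable

theorem eq_smul_one_add_volterra {u v : L2} {c : ℝ}
    (h : u =ᵐ[unitMeasure] fun x => c + prim v x) : u = c • one + volterra v := by
  apply Lp.ext
  filter_upwards [h, Lp.coeFn_add (c • one) (volterra v), Lp.coeFn_smul c one, coeFn_one,
    coeFn_volterra v] with x h1 h2 h3 h4 h5
  rw [h1, h2, Pi.add_apply, h3, Pi.smul_apply, h4, h5]
  simp

theorem coeFn_smul_one_add_volterra (c : ℝ) (v : L2) :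
    (c • one + volterra v : L2) =ᵐ[unitMeasure] fun x => c + prim v x := by
  filter_upwards [Lp.coeFn_add (c • one) (volterra v), Lp.coeFn_smul c one, coeFn_one,
    coeFn_volterra v] with x h2 h3 h4 h5
  rw [h2, Pi.add_apply, h3, Pi.smul_apply, h4, h5]
  simp

theorem eq_smul_one_add_volterra_derivWithin {s : ℝ → ℝ} (hs : ContDiffOn ℝ 1 s (Icc 0 1))
    {u v : L2} (hu : u =ᵐ[unitMeasure] s) (hv : v =ᵐ[unitMeasure] derivWithin s (Icc 0 1)) :
    u = s 0 • one + volterra v := by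
  refine eq_smul_one_add_volterra ?_
  filter_upwards [hu, ae_restrict_mem measurableSet_Ioo] with x hx hx01
  have hx01 := Ioo_subset_Icc_self hx01
  rw [hx, prim_congr hv hx01, prim_derivWithin hs hx01]
  ring

theorem exists_antiderivative (P : Polynomial ℝ) :
    ∃ Q : Polynomial ℝ, Q.natDegree ≤ P.natDegree + 1 ∧ Q.derivative = P := by
  refine ⟨∑ i ∈ Finset.range (P.natDegree + 1), Polynomial.monomial (i + 1) (P.coeff i / (i + 1)),
    ?_, ?_⟩
  · refine Polynomial.natDegree_sum_le_of_forall_le _ _ fun i hi => ?_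
    exact (Polynomial.natDegree_monomial_le _).trans (by have := Finset.mem_range.1 hi; omega)
  · rw [Polynomial.derivative_sum]
    nth_rewrite 3 [P.as_sum_range]
    refine Finset.sum_congr rfl fun i _ => ?_
    rw [Polynomial.derivative_monomial]
    have : (i : ℝ) + 1 ≠ 0 := by positivity
    congr 1
    push_cast
    field_simp

/-- The primitive of a piecewise polynomial is piecewise polynomial of one degree more. -/
theorem IsPiecewisePoly.prim {p n : ℕ} [NeZero n] {t : ℝ → ℝ} (ht : IsPiecewisePoly p n t) {u : L2}
    (hu : u =ᵐ[unitMeasure] t) (c : ℝ) : IsPiecewisePoly (p + 1) n fun x => c + prim u x := by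
  intro j hj
  obtain ⟨P, hP, hPt⟩ := ht j hj
  obtain ⟨Q, hQ, hQP⟩ := exists_antiderivative P
  have ha := node_mem_Icc hj.le
  have hb := node_succ_mem_Icc hj
  refine ⟨Polynomial.C (c + SplineApprox.prim u ((j : ℝ) / n) - Q.eval ((j : ℝ) / n)) + Q, ?_,
    fun x hx => ?_⟩
  · refine Polynomial.natDegree_add_le_of_degree_le ?_ (hQ.trans (by omega))
    rw [Polynomial.natDegree_C]; omega
  · have hx01 : x ∈ Icc (0 : ℝ) 1 := ⟨ha.1.trans hx.1, hx.2.le.trans hb.2⟩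
    have h1 : SplineApprox.prim u x
        = SplineApprox.prim u ((j : ℝ) / n) + ∫ y in ((j : ℝ) / n)..x, u y :=
      (intervalIntegral.integral_add_adjacent_intervals (intervalIntegrable_coe u (by simp) ha)
        (intervalIntegrable_coe u ha hx01)).symm
    have h2 : ∫ y in ((j : ℝ) / n)..x, u y = ∫ y in ((j : ℝ) / n)..x, P.eval y := by
      rw [integral_congr_unitMeasure hu ha hx01]
      refine intervalIntegral.integral_congr_ae (Filter.Eventually.of_forall fun y hy => ?_)
      rw [uIoc_of_le hx.1] at hy
      exact hPt y ⟨hy.1.le, hy.2.trans_lt hx.2⟩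
    have h3 : ∫ y in ((j : ℝ) / n)..x, P.eval y = Q.eval x - Q.eval ((j : ℝ) / n) := by
      refine intervalIntegral.integral_eq_sub_of_hasDerivAt (f := fun y => Q.eval y) (fun y _ => ?_)
        (P.continuous.intervalIntegrable _ _)
      simpa [hQP] using Q.hasDerivAt y
    change c + SplineApprox.prim u x = _
    rw [h1, h2, h3, Polynomial.eval_add, Polynomial.eval_C]
    ring

/-- The primitive of a `C^k` function is `C^(k+1)` up to the endpoints; the extension of `t` by
constants gives two-sided derivatives there. -/
theorem contDiffOn_prim {k : ℕ} {t : ℝ → ℝ} (ht : ContDiffOn ℝ k t (Icc 0 1)) {u : L2}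
    (hu : u =ᵐ[unitMeasure] t) : ContDiffOn ℝ ((k + 1 : ℕ)) (prim u) (Icc 0 1) := by
  set T : ℝ → ℝ := IccExtend zero_le_one ((Icc (0 : ℝ) 1).domRestrict t) with hT
  have hTc : Continuous T := (continuousOn_iff_continuous_domRestrict.1 ht.continuousOn).Icc_extend'
  have hTt : EqOn T t (Icc 0 1) := fun x hx => by rw [hT, IccExtend_of_mem _ _ hx]; rfl
  have huT : u =ᵐ[unitMeasure] T := by
    filter_upwards [hu, ae_restrict_mem measurableSet_Ioo] with x hx hx01
    rw [hx, hTt (Ioo_subset_Icc_self hx01)]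
  have hd : ∀ x ∈ Icc (0 : ℝ) 1, HasDerivWithinAt (prim u) (t x) (Icc 0 1) x := fun x hx => by
    rw [← hTt hx]
    have h1 : HasDerivAt (prim T) (T x) x := hTc.integral_hasStrictDerivAt 0 x |>.hasDerivAt
    exact h1.hasDerivWithinAt.congr (fun y hy => prim_congr huT hy) (prim_congr huT hx)
  push_cast
  rw [contDiffOn_succ_iff_derivWithin (uniqueDiffOn_Icc one_pos)]
  refine ⟨fun x hx => (hd x hx).differentiableWithinAt, by simp, ?_⟩
  exact ht.congr fun x hx => (hd x hx).derivWithin (uniqueDiffOn_Icc one_pos x hx)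

/-- Continuous splines are the primitives of discontinuous piecewise polynomials: the derivative of a
continuous spline exists off the nodes, which is enough for the fundamental theorem of calculus. -/
theorem splineSpace_zero_eq_primitives (p n : ℕ) [NeZero n] :
    splineSpace (p + 1) 0 n = primitives (brokenSpace p n) := by
  ext u
  rw [mem_primitives]
  constructor
  · rintro ⟨s, ⟨hs, hs'⟩, hu⟩
    have hs := hs.continuousOn
    choose! P hP hPs using hs'
    -- the derivative of `s`, which may jump at the nodes
    obtain ⟨v, hv, t, hvt, ht⟩ := exists_mem_span_brokenBasis (p := p) (n := n)
      (P := fun j => (P j).derivative)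
      fun j hj => ((P j).natDegree_derivative_le).trans (by have := hP j hj; omega)
    rw [← brokenSpace_eq_span] at hv
    have hprim : ∀ x ∈ Icc (0 : ℝ) 1, prim v x = s x - s 0 := fun x hx => by
      rw [prim_congr hvt hx]
      refine integral_eq_of_hasDerivAt_off_countable s t
        (countable_range fun j : ℕ => (j : ℝ) / n)
        (hs.mono (by rw [uIcc_of_le hx.1]; exact Icc_subset_Icc_right hx.2)) (fun y hy => ?_) ?_
      · rw [min_eq_left hx.1, max_eq_right hx.1] at hy
        obtain ⟨j, hj, hseg⟩ := exists_segment (n := n) (x := y)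
          ⟨hy.1.1.le, hy.1.2.trans_le hx.2⟩
        have hyj := (hseg j).2 rfl
        have hyj' : (j : ℝ) / n < y := lt_of_le_of_ne hyj.1 fun h => hy.2 ⟨j, h⟩
        rw [ht j hj y hyj]
        refine ((P j).hasDerivAt y).congr_of_eventuallyEq ?_
        filter_upwards [Ioo_mem_nhds hyj' hyj.2] with z hz
        exact hPs j hj z (Ioo_subset_Ico_self hz)
      · have h := intervalIntegrable_coe v (a := 0) (b := x) (by simp) hx
        rw [intervalIntegrable_iff_integrableOn_Ioo_of_le hx.1] at h ⊢
        exact (integrable_congr (ae_restrict_of_ae_restrict_of_subset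
          (Ioo_subset_Ioo_right hx.2) hvt)).1 h
    refine ⟨s 0, v, hv, eq_smul_one_add_volterra ?_⟩
    filter_upwards [hu, ae_restrict_mem measurableSet_Ioo] with x hx hx01
    rw [hx, hprim x (Ioo_subset_Icc_self hx01)]
    ring
  · rintro ⟨c, v, ⟨t, ht, hvt⟩, rfl⟩
    refine ⟨fun x => c + prim v x, ⟨?_, ht.prim hvt c⟩, coeFn_smul_one_add_volterra c v⟩
    exact contDiffOn_zero.2 (continuousOn_const.add (continuousOn_prim v))

/-- Differentiating a spline lowers both the degree and the smoothness by one. -/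
theorem splineSpace_succ_eq_primitives (p k n : ℕ) [NeZero n] :
    splineSpace (p + 1) (k + 1) n = primitives (splineSpace p k n) := by
  ext u
  rw [mem_primitives]
  constructor
  · rintro ⟨s, ⟨hs, hs'⟩, hu⟩
    have h1 : ContDiffOn ℝ 1 s (Icc 0 1) := hs.of_le (by exact_mod_cast Nat.le_add_left 1 k)
    have h2 : ContDiffOn ℝ k (derivWithin s (Icc 0 1)) (Icc 0 1) :=
      hs.derivWithin (uniqueDiffOn_Icc one_pos) (by push_cast; exact le_rfl)
    have hm := memLp_of_continuousOn h2.continuousOn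
    exact ⟨s 0, hm.toLp, ⟨_, ⟨h2, IsPiecewisePoly.derivWithin hs' (h1.differentiableOn one_ne_zero)⟩,
      hm.coeFn_toLp⟩, eq_smul_one_add_volterra_derivWithin h1 hu hm.coeFn_toLp⟩
  · rintro ⟨c, v, ⟨t, ⟨ht, ht'⟩, hvt⟩, rfl⟩
    exact ⟨fun x => c + prim v x, ⟨contDiffOn_const.add (contDiffOn_prim ht hvt),
      IsPiecewisePoly.prim ht' hvt c⟩, coeFn_smul_one_add_volterra c v⟩

/-! ### Sobolev functions are iterated primitives -/

theorem absolutelyContinuous_of_contDiff {φ : ℝ → ℝ} (hφ : ContDiff ℝ ∞ φ) :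
    AbsolutelyContinuousOnInterval φ 0 1 :=
  (hφ.of_le (by simp)).contDiffOn.absolutelyContinuousOnInterval

theorem eq_zero_of_notMem {φ : ℝ → ℝ} (hs : tsupport φ ⊆ Ioo (0 : ℝ) 1) {x : ℝ}
    (hx : x ∉ Ioo (0 : ℝ) 1) : φ x = 0 :=
  image_eq_zero_of_notMem_tsupport fun h => hx (hs h)

/-- The fundamental lemma of the calculus of variations on `(0, 1)`. -/
theorem ae_eq_zero_of_integral_test {w : ℝ → ℝ} (hw : MemLp w 2 unitMeasure)
    (h : ∀ φ : ℝ → ℝ, ContDiff ℝ ∞ φ → HasCompactSupport φ → tsupport φ ⊆ Ioo (0 : ℝ) 1 →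
      ∫ x in Ioo (0 : ℝ) 1, w x * φ x = 0) : w =ᵐ[unitMeasure] fun _ => 0 := by
  rw [Filter.EventuallyEq, ae_restrict_iff' measurableSet_Ioo]
  refine isOpen_Ioo.ae_eq_zero_of_integral_contDiff_smul_eq_zero
    (IntegrableOn.locallyIntegrableOn (hw.integrable (by norm_num))) fun φ h1 h2 h3 => ?_
  rw [← h φ h1 h2 h3, ← setIntegral_eq_integral_of_forall_compl_eq_zero (s := Ioo 0 1)]
  · simp [mul_comm]
  · intro x hx
    simp [eq_zero_of_notMem h3 hx]

theorem IsWeakDeriv.unique {j : ℕ} {u v w : L2} (hv : IsWeakDeriv j u v) (hw : IsWeakDeriv j u w) :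
    v = w := by
  rw [← sub_eq_zero]
  apply Lp.ext
  refine (ae_eq_zero_of_integral_test (Lp.memLp _) fun φ h1 h2 h3 => ?_).trans
    (Lp.coeFn_zero ℝ 2 unitMeasure).symm
  have h := (hv φ h1 h2 h3).symm.trans (hw φ h1 h2 h3)
  have h' := mul_left_cancel₀ (pow_ne_zero j (by norm_num : (-1 : ℝ) ≠ 0)) h
  have hint : ∀ v : L2, Integrable (fun x => v x * φ x) unitMeasure := fun v =>
    (Lp.memLp v).integrable_mul (p := 2) (q := 2) (memLp_of_continuousOn h1.continuous.continuousOn)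
  rw [← sub_eq_zero, ← integral_sub (hint v) (hint w)] at h'
  refine (integral_congr_ae ?_).trans h'
  filter_upwards [Lp.coeFn_sub v w] with x hx
  rw [hx, Pi.sub_apply, sub_mul]

theorem IsWeakDeriv.deriv {j : ℕ} {u v w : L2} (hv : IsWeakDeriv j u v)
    (hw : IsWeakDeriv (j + 1) u w) : IsWeakDeriv 1 v w := by
  intro φ h1 h2 h3
  have a := hv (_root_.deriv φ) ((contDiff_infty_iff_deriv.1 h1).2) h2.deriv
    ((tsupport_deriv_subset (𝕜 := ℝ)).trans h3)
  have b := hw φ h1 h2 h3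
  rw [iteratedDeriv_succ', a, pow_succ, mul_assoc] at b
  rw [iteratedDeriv_one, pow_one]
  exact mul_left_cancel₀ (pow_ne_zero j (by norm_num : (-1 : ℝ) ≠ 0)) b

theorem isWeakDeriv_volterra (v : L2) : IsWeakDeriv 1 (volterra v) v := by
  intro φ h1 h2 h3
  have h := (absolutelyContinuous_prim v).integral_mul_deriv_eq_deriv_mul
    (absolutelyContinuous_of_contDiff h1)
  rw [eq_zero_of_notMem h3 (by simp : (0 : ℝ) ∉ Ioo (0 : ℝ) 1),
    eq_zero_of_notMem h3 (by simp : (1 : ℝ) ∉ Ioo (0 : ℝ) 1),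
    intervalIntegral.integral_of_le zero_le_one, intervalIntegral.integral_of_le zero_le_one,
    integral_Ioc_eq_integral_Ioo, integral_Ioc_eq_integral_Ioo] at h
  rw [iteratedDeriv_one]
  have e1 : ∫ x in Ioo (0 : ℝ) 1, volterra v x * deriv φ x
      = ∫ x in Ioo (0 : ℝ) 1, prim v x * deriv φ x := by
    refine integral_congr_ae ?_
    filter_upwards [coeFn_volterra v] with x hx
    rw [hx]
  have e2 : ∫ x in Ioo (0 : ℝ) 1, v x * φ x = ∫ x in Ioo (0 : ℝ) 1, deriv (prim v) x * φ x := by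
    refine integral_congr_ae ?_
    filter_upwards [deriv_prim v] with x hx
    rw [hx]
  rw [e1, e2, h]
  ring

/-- A test function with integral zero has a test function as primitive. -/
theorem exists_primitive_test {ψ : ℝ → ℝ} (h1 : ContDiff ℝ ∞ ψ) (h2 : HasCompactSupport ψ)
    (h3 : tsupport ψ ⊆ Ioo (0 : ℝ) 1) (h0 : ∫ x in Ioo (0 : ℝ) 1, ψ x = 0) :
    ∃ φ : ℝ → ℝ, ContDiff ℝ ∞ φ ∧ HasCompactSupport φ ∧ tsupport φ ⊆ Ioo (0 : ℝ) 1 ∧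
      deriv φ = ψ := by
  obtain ⟨a, b, ha, hb, hab⟩ : ∃ a b : ℝ, 0 < a ∧ b < 1 ∧ tsupport ψ ⊆ Icc a b := by
    rcases (tsupport ψ).eq_empty_or_nonempty with he | hne
    · exact ⟨1 / 2, 1 / 2, by norm_num, by norm_num, by simp [he]⟩
    · obtain ⟨a, ha, ha'⟩ := h2.exists_isLeast hne
      obtain ⟨b, hb, hb'⟩ := h2.exists_isGreatest hne
      exact ⟨a, b, (h3 ha).1, (h3 hb).2, fun x hx => ⟨ha' hx, hb' hx⟩⟩
  have hd : ∀ x, HasDerivAt (fun x => ∫ t in (0 : ℝ)..x, ψ t) (ψ x) x := fun x =>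
    (h1.continuous.integral_hasStrictDerivAt 0 x).hasDerivAt
  have hderiv : deriv (fun x => ∫ t in (0 : ℝ)..x, ψ t) = ψ := funext fun x => (hd x).deriv
  have hz : ∀ x ∉ Icc a b, ψ x = 0 := fun x hx =>
    image_eq_zero_of_notMem_tsupport fun h => hx (hab h)
  have hsupp : tsupport (fun x => ∫ t in (0 : ℝ)..x, ψ t) ⊆ Icc a b := by
    refine closure_minimal (fun x hx => ?_) isClosed_Icc
    by_contra hx'
    apply hx
    rw [mem_Icc, not_and_or, not_le, not_le] at hx'
    change ∫ t in (0 : ℝ)..x, ψ t = 0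
    rcases hx' with hlt | hlt
    · rw [intervalIntegral.integral_congr (g := fun _ => (0 : ℝ)), intervalIntegral.integral_zero]
      intro t ht
      refine hz t fun h => ?_
      rcases le_max_iff.1 (h.1.trans ht.2) with h' | h' <;> linarith
    · have e : ∫ t in (0 : ℝ)..1, ψ t = 0 := by
        rw [intervalIntegral.integral_of_le zero_le_one, integral_Ioc_eq_integral_Ioo, h0]
      have e' : ∫ t in x..1, ψ t = 0 := by
        rw [intervalIntegral.integral_congr (g := fun _ => (0 : ℝ)), intervalIntegral.integral_zero]
        intro t ht
        refine hz t fun h => ?_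
        rcases min_le_iff.1 (ht.1.trans h.2) with h' | h' <;> linarith
      have := intervalIntegral.integral_add_adjacent_intervals
        (h1.continuous.intervalIntegrable (μ := volume) 0 x) (h1.continuous.intervalIntegrable x 1)
      rw [e, e', add_zero] at this
      exact this
  refine ⟨_, ?_, isCompact_Icc.of_isClosed_subset (isClosed_tsupport _) hsupp,
    hsupp.trans (Icc_subset_Ioo ha hb), hderiv⟩
  rw [contDiff_infty_iff_deriv, hderiv]
  exact ⟨fun x => (hd x).differentiableAt, h1⟩

theorem exists_test_integral_eq_one : ∃ ψ : ℝ → ℝ, ContDiff ℝ ∞ ψ ∧ HasCompactSupport ψ ∧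
    tsupport ψ ⊆ Ioo (0 : ℝ) 1 ∧ ∫ x in Ioo (0 : ℝ) 1, ψ x = 1 := by
  let f : ContDiffBump (1 / 2 : ℝ) := ⟨1 / 8, 1 / 4, by norm_num, by norm_num⟩
  have hs : tsupport (f.normed volume) ⊆ Ioo (0 : ℝ) 1 := by
    rw [f.tsupport_normed_eq]
    intro x hx
    rw [Metric.mem_closedBall, Real.dist_eq, abs_le] at hx
    have h1 : f.rOut = 1 / 4 := rfl
    rw [h1] at hx
    exact ⟨by linarith [hx.1], by linarith [hx.2]⟩
  refine ⟨f.normed volume, f.contDiff_normed, f.hasCompactSupport_normed, hs, ?_⟩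
  rw [setIntegral_eq_integral_of_forall_compl_eq_zero fun x hx => eq_zero_of_notMem hs hx,
    f.integral_normed]

/-- The du Bois-Reymond lemma: a function with weak derivative `v` is a primitive of `v`. -/
theorem IsWeakDeriv.exists_eq_primitive {u v : L2} (h : IsWeakDeriv 1 u v) :
    ∃ c : ℝ, u = c • one + volterra v := by
  obtain ⟨ψ, hψ1, hψ2, hψ3, hψ⟩ := exists_test_integral_eq_one
  set w : L2 := u - volterra v with hw
  have hint : ∀ (w : L2) {φ : ℝ → ℝ}, ContDiff ℝ ∞ φ →
      Integrable (fun x => w x * φ x) unitMeasure := fun w φ h1 =>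
    (Lp.memLp w).integrable_mul (p := 2) (q := 2) (memLp_of_continuousOn h1.continuous.continuousOn)
  have hint1 : ∀ {φ : ℝ → ℝ}, ContDiff ℝ ∞ φ → Integrable φ unitMeasure := fun h1 =>
    (memLp_of_continuousOn h1.continuous.continuousOn).integrable (by norm_num)
  -- `w` annihilates every derivative of a test function
  have h0 : ∀ φ : ℝ → ℝ, ContDiff ℝ ∞ φ → HasCompactSupport φ → tsupport φ ⊆ Ioo (0 : ℝ) 1 →
      ∫ x in Ioo (0 : ℝ) 1, w x * _root_.deriv φ x = 0 := by
    intro φ h1 h2 h3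
    have a := h φ h1 h2 h3
    have b := isWeakDeriv_volterra v φ h1 h2 h3
    rw [iteratedDeriv_one] at a b
    have hd := (contDiff_infty_iff_deriv.1 h1).2
    have hz := sub_eq_zero.2 (a.trans b.symm)
    rw [← integral_sub (hint u hd) (hint _ hd)] at hz
    refine (integral_congr_ae ?_).trans hz
    filter_upwards [Lp.coeFn_sub u (volterra v)] with x hx
    rw [hw, hx, Pi.sub_apply, sub_mul]
  set c := ∫ x in Ioo (0 : ℝ) 1, w x * ψ x with hc
  refine ⟨c, eq_smul_one_add_volterra ?_⟩
  have key : (fun x => w x - c) =ᵐ[unitMeasure] fun _ => 0 := by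
    refine ae_eq_zero_of_integral_test ((Lp.memLp w).sub (memLp_const c)) fun χ h1 h2 h3 => ?_
    set I := ∫ x in Ioo (0 : ℝ) 1, χ x with hI
    have g1 : ContDiff ℝ ∞ (fun x => χ x - I * ψ x) := h1.sub (contDiff_const.mul hψ1)
    have gs : tsupport (fun x => χ x - I * ψ x) ⊆ tsupport χ ∪ tsupport ψ := by
      refine closure_minimal (fun x hx => ?_) ((isClosed_tsupport _).union (isClosed_tsupport _))
      by_contra hx'
      rw [mem_union, not_or] at hx'
      apply hx
      simp [image_eq_zero_of_notMem_tsupport hx'.1, image_eq_zero_of_notMem_tsupport hx'.2]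
    have g2 : HasCompactSupport (fun x => χ x - I * ψ x) :=
      (IsCompact.union h2 hψ2).of_isClosed_subset (isClosed_tsupport _) gs
    have g0 : ∫ x in Ioo (0 : ℝ) 1, (χ x - I * ψ x) = 0 := by
      rw [integral_sub (hint1 h1) ((hint1 hψ1).const_mul I), integral_const_mul, hψ, ← hI]
      ring
    obtain ⟨φ, e1, e2, e3, e4⟩ := exists_primitive_test g1 g2 (gs.trans (union_subset h3 hψ3)) g0
    have := h0 φ e1 e2 e3
    rw [e4] at this
    have e5 : ∫ x in Ioo (0 : ℝ) 1, (w x - c) * χ x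
        = (∫ x in Ioo (0 : ℝ) 1, w x * χ x) - c * I := by
      rw [hI, ← integral_const_mul, ← integral_sub (hint w h1) ((hint1 h1).const_mul c)]
      simp only [sub_mul]
    have e6 : ∫ x in Ioo (0 : ℝ) 1, w x * (χ x - I * ψ x)
        = (∫ x in Ioo (0 : ℝ) 1, w x * χ x) - I * c := by
      rw [hc, ← integral_const_mul, ← integral_sub (hint w h1) ((hint w hψ1).const_mul I)]
      congr 1
      ext x
      ring
    rw [e5, mul_comm c, ← e6]
    exact this
  filter_upwards [key, Lp.coeFn_sub u (volterra v), coeFn_volterra v] with x h1 h2 h3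
  rw [hw, h2, Pi.sub_apply, h3] at h1
  linarith

/-- Peeling off one derivative at a time: consecutive weak derivatives of `f` are linked by the
du Bois-Reymond lemma. -/
theorem isPrimitive_of_isWeakDeriv {i j : ℕ} {f u g : L2} (hu : IsWeakDeriv j f u)
    (hg : IsWeakDeriv (j + i) f g) (hf : ∀ k ≤ j + i, ∃ v, IsWeakDeriv k f v) :
    IsPrimitive i u g := by
  induction i generalizing j u with
  | zero => exact hu.unique hg
  | succ i ih =>
    obtain ⟨v, hv⟩ := hf (j + 1) (by omega)
    obtain ⟨c, hc⟩ := (hu.deriv hv).exists_eq_primitive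
    exact ⟨c, v, hc, ih hv (by rwa [add_assoc, add_comm 1]) fun k hk => hf k (by omega)⟩

theorem isPrimitive_of_mem_sobolev {r : ℕ} {f g : L2} (hf : f ∈ sobolev r)
    (hg : IsWeakDeriv r f g) : IsPrimitive r f g :=
  isPrimitive_of_isWeakDeriv (j := 0) (f := f) (u := f)
    (fun φ _ _ _ => by simp [iteratedDeriv_zero]) (by rwa [zero_add])
    (by rwa [zero_add])

/-! ### A lower bound for approximation by piecewise polynomials -/

section Legendre

open Polynomial

theorem integral_mul_derivative (A w : ℝ[X]) (h0 : w.eval 0 = 0) (h1 : w.eval 1 = 0) :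
    ∫ x in (0 : ℝ)..1, A.eval x * (derivative w).eval x
      = -∫ x in (0 : ℝ)..1, (derivative A).eval x * w.eval x := by
  rw [intervalIntegral.integral_mul_deriv_eq_deriv_mul (u := fun x => A.eval x)
    (v := fun x => w.eval x) (fun x _ => A.hasDerivAt x) (fun x _ => w.hasDerivAt x)
    ((derivative A).continuous.intervalIntegrable _ _)
    ((derivative w).continuous.intervalIntegrable _ _), h0, h1]
  ring

/-- Repeated integration by parts against a polynomial vanishing to order `r` at both endpoints. -/
theorem integral_mul_iterate_derivative (w : ℝ[X]) (r : ℕ) (A : ℝ[X])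
    (h0 : ∀ i < r, (derivative^[i] w).eval 0 = 0) (h1 : ∀ i < r, (derivative^[i] w).eval 1 = 0) :
    ∫ x in (0 : ℝ)..1, A.eval x * (derivative^[r] w).eval x
      = (-1) ^ r * ∫ x in (0 : ℝ)..1, (derivative^[r] A).eval x * w.eval x := by
  induction r generalizing A with
  | zero => simp
  | succ r ih =>
    rw [Function.iterate_succ_apply', integral_mul_derivative _ _ (h0 r (by omega))
      (h1 r (by omega)), ih _ (fun i hi => h0 i (by omega)) (fun i hi => h1 i (by omega)),
      ← Function.iterate_succ_apply]
    ring

/-- The Beta integral at natural numbers. -/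
theorem integral_pow_mul_one_sub_pow (a b : ℕ) :
    ∫ x in (0 : ℝ)..1, x ^ a * (1 - x) ^ b
      = (a.factorial : ℝ) * b.factorial / (a + b + 1).factorial := by
  induction b generalizing a with
  | zero =>
    simp only [pow_zero, mul_one, integral_pow, add_zero, Nat.factorial_zero, Nat.factorial_succ]
    push_cast
    field_simp
    simp
  | succ b ih =>
    have h := intervalIntegral.integral_mul_deriv_eq_deriv_mul (a := 0) (b := 1)
      (u := fun x : ℝ => (1 - x) ^ (b + 1)) (u' := fun x : ℝ => -((b + 1) * (1 - x) ^ b))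
      (v := fun x : ℝ => x ^ (a + 1)) (v' := fun x => (a + 1) * x ^ a)
      (fun x _ => by
        refine (((hasDerivAt_id x).const_sub 1).pow (b + 1)).congr_deriv ?_
        simp)
      (fun x _ => by simpa using hasDerivAt_pow (a + 1) x)
      (Continuous.intervalIntegrable (by fun_prop) _ _)
      (Continuous.intervalIntegrable (by fun_prop) _ _)
    have e1 : ∫ x in (0 : ℝ)..1, (1 - x) ^ (b + 1) * ((a + 1) * x ^ a)
        = (a + 1) * ∫ x in (0 : ℝ)..1, x ^ a * (1 - x) ^ (b + 1) := by
      rw [← intervalIntegral.integral_const_mul]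
      congr 1; ext x; ring
    have e2 : ∫ x in (0 : ℝ)..1, -((b + 1) * (1 - x) ^ b) * x ^ (a + 1)
        = -(b + 1) * ∫ x in (0 : ℝ)..1, x ^ (a + 1) * (1 - x) ^ b := by
      rw [← intervalIntegral.integral_const_mul]
      congr 1; ext x; ring
    rw [e1, e2, ih] at h
    have ha : (a + 1 : ℝ) ≠ 0 := by positivity
    apply mul_left_cancel₀ ha
    rw [h, show a + (b + 1) + 1 = a + 1 + b + 1 by ring, Nat.factorial_succ a, Nat.factorial_succ b]
    push_cast
    simp
    ring

/-- The weight in Rodrigues' formula for the shifted Legendre polynomial of degree `r`. -/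
noncomputable def rodriguesWeight (r : ℕ) : ℝ[X] := X ^ r * (1 - X) ^ r

theorem eval_iterate_derivative_rodriguesWeight {r i : ℕ} (hi : i < r) :
    (derivative^[i] (rodriguesWeight r)).eval 0 = 0 ∧
      (derivative^[i] (rodriguesWeight r)).eval 1 = 0 := by
  have h : ∀ q : ℝ[X], ∀ x : ℝ, q.eval x = 0 → q ^ r ∣ rodriguesWeight r →
      (derivative^[i] (rodriguesWeight r)).eval x = 0 := fun q x hx hq => by
    have h1 := (dvd_pow_self q (by omega : r - i ≠ 0)).trans
      (pow_sub_dvd_iterate_derivative_of_pow_dvd i hq)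
    obtain ⟨s, hs⟩ := h1
    rw [hs, eval_mul, hx, zero_mul]
  exact ⟨h X 0 (by simp) (dvd_mul_right _ _), h (1 - X) 1 (by simp) (dvd_mul_left _ _)⟩

theorem integral_mul_rodrigues (r : ℕ) (A : ℝ[X]) :
    ∫ x in (0 : ℝ)..1, A.eval x * (derivative^[r] (rodriguesWeight r)).eval x
      = (-1) ^ r * ∫ x in (0 : ℝ)..1, (derivative^[r] A).eval x * (rodriguesWeight r).eval x :=
  integral_mul_iterate_derivative _ r A (fun _ hi => (eval_iterate_derivative_rodriguesWeight hi).1)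
    fun _ hi => (eval_iterate_derivative_rodriguesWeight hi).2

theorem integral_rodriguesWeight (r : ℕ) :
    ∫ x in (0 : ℝ)..1, (rodriguesWeight r).eval x
      = (r.factorial : ℝ) ^ 2 / (2 * r + 1).factorial := by
  simp only [rodriguesWeight, eval_mul, eval_pow, eval_X, eval_sub, eval_one]
  rw [integral_pow_mul_one_sub_pow, two_mul, sq]

theorem iterate_derivative_eq_C {r : ℕ} {A : ℝ[X]} (hA : A.natDegree ≤ r) :
    derivative^[r] A = C (r.factorial * A.coeff r) := by
  have h : (derivative^[r] A).natDegree ≤ 0 :=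
    (natDegree_iterate_derivative A r).trans (by omega)
  rw [eq_C_of_natDegree_le_zero h, coeff_iterate_derivative, zero_add, Nat.descFactorial_self,
    nsmul_eq_mul]

theorem natDegree_rodriguesWeight (r : ℕ) : (rodriguesWeight r).natDegree ≤ r + r := by
  refine natDegree_mul_le_of_le (natDegree_X_pow_le r) (natDegree_pow_le_of_le r ?_ |>.trans_eq
    (mul_one r))
  exact (natDegree_sub_le _ _).trans (by simp)

theorem coeff_rodriguesWeight (r : ℕ) : (rodriguesWeight r).coeff (r + r) = (-1) ^ r := by
  rw [rodriguesWeight, coeff_X_pow_mul]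
  have h : (1 - X : ℝ[X]) = C (-1) * (X - C 1) := by simp
  have hm := ((monic_X_sub_C (1 : ℝ)).pow r).coeff_natDegree
  rw [natDegree_pow, natDegree_X_sub_C, mul_one] at hm
  rw [h, mul_pow, ← C_pow, coeff_C_mul, hm, mul_one]

/-- Among polynomials of degree `r` with given leading coefficient, the Legendre polynomial has the
smallest norm on `(0, 1)`. -/
theorem le_integral_sq {r : ℕ} {Q : ℝ[X]} (hQ : Q.natDegree ≤ r) :
    Q.coeff r ^ 2 * ((r.factorial : ℝ) ^ 4 / ((2 * r).factorial * (2 * r + 1).factorial))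
      ≤ ∫ x in (0 : ℝ)..1, Q.eval x ^ 2 := by
  set w := rodriguesWeight r with hw
  set L := derivative^[r] w with hL
  set B : ℝ := (r.factorial : ℝ) ^ 2 / (2 * r + 1).factorial with hB
  have h1 : ∫ x in (0 : ℝ)..1, Q.eval x * L.eval x
      = (-1) ^ r * (r.factorial * Q.coeff r * B) := by
    rw [hL, integral_mul_rodrigues, iterate_derivative_eq_C hQ]
    simp only [eval_C]
    rw [intervalIntegral.integral_const_mul, integral_rodriguesWeight]
  have h2 : ∫ x in (0 : ℝ)..1, L.eval x * L.eval x = (2 * r).factorial * B := by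
    rw [hL, integral_mul_rodrigues, ← Function.iterate_add_apply,
      iterate_derivative_eq_C (natDegree_rodriguesWeight r), coeff_rodriguesWeight]
    simp only [eval_C]
    rw [intervalIntegral.integral_const_mul, integral_rodriguesWeight, ← two_mul]
    have : ((-1 : ℝ) ^ r) * (-1) ^ r = 1 := by rw [← mul_pow]; simp
    linear_combination ((2 * r).factorial * B : ℝ) * this
  have hB0 : 0 < B := by positivity
  -- the optimal multiple of the Legendre polynomial
  set t : ℝ := (-1) ^ r * (r.factorial * Q.coeff r) / (2 * r).factorial with ht
  have hpos : 0 ≤ ∫ x in (0 : ℝ)..1, (Q.eval x - t * L.eval x) ^ 2 :=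
    intervalIntegral.integral_nonneg zero_le_one fun x _ => sq_nonneg _
  have hexp : ∫ x in (0 : ℝ)..1, (Q.eval x - t * L.eval x) ^ 2
      = (∫ x in (0 : ℝ)..1, Q.eval x ^ 2) - 2 * t * (∫ x in (0 : ℝ)..1, Q.eval x * L.eval x)
        + t ^ 2 * ∫ x in (0 : ℝ)..1, L.eval x * L.eval x := by
    rw [← intervalIntegral.integral_const_mul, ← intervalIntegral.integral_const_mul,
      ← intervalIntegral.integral_sub, ← intervalIntegral.integral_add]
    · congr 1; ext x; ring
    all_goals exact Continuous.intervalIntegrable (by fun_prop) _ _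
  rw [hexp, h1, h2] at hpos
  have hF : ((2 * r).factorial : ℝ) ≠ 0 := by positivity
  have hs : ((-1 : ℝ) ^ r) ^ 2 = 1 := by rw [← pow_mul, mul_comm, pow_mul]; simp
  have e : Q.coeff r ^ 2 * ((r.factorial : ℝ) ^ 4 / ((2 * r).factorial * (2 * r + 1).factorial))
      = 2 * t * ((-1) ^ r * (r.factorial * Q.coeff r * B)) - t ^ 2 * ((2 * r).factorial * B) := by
    rw [ht, hB]
    field_simp
    rw [hs]
    ring
  rw [e]
  linarith

/-- `le_integral_sq` transported to a segment of length `h` by an affine change of variable. -/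
theorem le_integral_sq_segment {r : ℕ} {R : ℝ[X]} (hR : R.Monic) (hd : R.natDegree = r) {a h : ℝ}
    (hh : 0 < h) :
    h ^ (2 * r + 1) * ((r.factorial : ℝ) ^ 4 / ((2 * r).factorial * (2 * r + 1).factorial))
      ≤ ∫ x in a..(a + h), R.eval x ^ 2 := by
  have hlin : (C h * X + C a).natDegree = 1 := natDegree_linear hh.ne'
  have hc : (R.comp (C h * X + C a)).coeff r = h ^ r := by
    have := coeff_comp_degree_mul_degree (p := R) (q := C h * X + C a) (by rw [hlin]; norm_num)
    rwa [hlin, mul_one, hd, hR.leadingCoeff, one_mul, leadingCoeff_linear hh.ne'] at this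
  have hQ : (R.comp (C h * X + C a)).natDegree ≤ r := by
    rw [natDegree_comp, hlin, mul_one, hd]
  have key := le_integral_sq hQ
  have hsub := intervalIntegral.mul_integral_comp_mul_add (a := 0) (b := 1)
    (f := fun x => R.eval x ^ 2) h a
  have he : ∫ x in (0 : ℝ)..1, (R.comp (C h * X + C a)).eval x ^ 2
      = ∫ x in (0 : ℝ)..1, R.eval (h * x + a) ^ 2 := by simp
  rw [he, hc] at key
  rw [mul_zero, mul_one, zero_add, add_comm h a] at hsub
  rw [← hsub]
  calc _ = h * ((h ^ r) ^ 2 * ((r.factorial : ℝ) ^ 4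
        / ((2 * r).factorial * (2 * r + 1).factorial))) := by ring
    _ ≤ _ := by gcongr

theorem isWeakDeriv_polynomial (P : ℝ[X]) (j : ℕ) {u v : L2}
    (hu : u =ᵐ[unitMeasure] fun x => P.eval x)
    (hv : v =ᵐ[unitMeasure] fun x => (derivative^[j] P).eval x) : IsWeakDeriv j u v := by
  have key : ∀ (j : ℕ) (φ : ℝ → ℝ), ContDiff ℝ ∞ φ → tsupport φ ⊆ Ioo (0 : ℝ) 1 →
      ∫ x in (0 : ℝ)..1, P.eval x * iteratedDeriv j φ x
        = (-1) ^ j * ∫ x in (0 : ℝ)..1, (derivative^[j] P).eval x * φ x := by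
    intro j
    induction j with
    | zero => intro φ _ _; simp
    | succ j ih =>
      intro φ h1 h3
      have hd := contDiff_infty_iff_deriv.1 h1
      rw [iteratedDeriv_succ', ih _ hd.2 ((tsupport_deriv_subset (𝕜 := ℝ)).trans h3),
        intervalIntegral.integral_mul_deriv_eq_deriv_mul
        (u := fun x => (derivative^[j] P).eval x) (v := φ)
        (fun x _ => (derivative^[j] P).hasDerivAt x) (fun x _ => (hd.1 x).hasDerivAt)
        ((derivative _).continuous.intervalIntegrable _ _)
        (hd.2.continuous.intervalIntegrable _ _),
        eq_zero_of_notMem h3 (by simp : (0 : ℝ) ∉ Ioo (0 : ℝ) 1),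
        eq_zero_of_notMem h3 (by simp : (1 : ℝ) ∉ Ioo (0 : ℝ) 1), Function.iterate_succ_apply']
      ring
  intro φ h1 _ h3
  have h := key j φ h1 h3
  rw [intervalIntegral.integral_of_le zero_le_one, intervalIntegral.integral_of_le zero_le_one,
    integral_Ioc_eq_integral_Ioo, integral_Ioc_eq_integral_Ioo] at h
  have e1 : ∫ x in Ioo (0 : ℝ) 1, u x * iteratedDeriv j φ x
      = ∫ x in Ioo (0 : ℝ) 1, P.eval x * iteratedDeriv j φ x :=
    integral_congr_ae (by filter_upwards [hu] with x hx; rw [hx])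
  have e2 : ∫ x in Ioo (0 : ℝ) 1, v x * φ x = ∫ x in Ioo (0 : ℝ) 1, (derivative^[j] P).eval x * φ x :=
    integral_congr_ae (by filter_upwards [hv] with x hx; rw [hx])
  rw [e1, e2, h]

theorem memLp_polynomial (P : ℝ[X]) : MemLp (fun x => P.eval x) 2 unitMeasure :=
  memLp_of_continuousOn P.continuous.continuousOn

/-- A lower bound for the squared distance of `x ^ (p + 1)` to the piecewise polynomials of
degree at most `p`. -/
theorem le_norm_sub_sq {p n : ℕ} [NeZero n] {u v : L2}
    (hu : u =ᵐ[unitMeasure] fun x => x ^ (p + 1)) (hv : v ∈ brokenSpace p n) :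
    (1 / (n : ℝ)) ^ (2 * (p + 1)) * (((p + 1).factorial : ℝ) ^ 4
      / ((2 * (p + 1)).factorial * (2 * (p + 1) + 1).factorial)) ≤ ‖u - v‖ ^ 2 := by
  have hn : (0 : ℝ) < n := Nat.cast_pos.2 (NeZero.pos n)
  set E : ℝ := ((p + 1).factorial : ℝ) ^ 4
      / ((2 * (p + 1)).factorial * (2 * (p + 1) + 1).factorial) with hE
  obtain ⟨t, ht, hvt⟩ := hv
  have hseg : ∀ j ∈ Finset.range n, (1 / (n : ℝ)) ^ (2 * (p + 1) + 1) * E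
      ≤ ∫ x in ((j : ℝ) / n)..(((j : ℝ) + 1) / n), (u - v : L2) x ^ 2 := by
    intro j hj
    have hj := Finset.mem_range.1 hj
    obtain ⟨P, hP, hPt⟩ := ht j hj
    have hdeg : P.degree < ((p + 1 : ℕ) : WithBot ℕ) :=
      degree_le_natDegree.trans_lt (by exact_mod_cast Nat.lt_succ_of_le hP)
    have hmonic : (X ^ (p + 1) - P).Monic := monic_X_pow_sub hdeg
    have hnat : (X ^ (p + 1) - P).natDegree = p + 1 := by
      rw [natDegree_sub_eq_left_of_natDegree_lt] <;> rw [natDegree_X_pow]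
      omega
    have key := le_integral_sq_segment hmonic hnat (a := (j : ℝ) / n) (h := 1 / n) (by positivity)
    rw [← add_div] at key
    refine key.trans_eq ?_
    have hae : (fun x => (u - v : L2) x ^ 2) =ᵐ[unitMeasure] fun x => (x ^ (p + 1) - t x) ^ 2 := by
      filter_upwards [Lp.coeFn_sub u v, hu, hvt] with x h1 h2 h3
      rw [h1, Pi.sub_apply, h2, h3]
    rw [integral_congr_unitMeasure hae (node_mem_Icc hj.le) (node_succ_mem_Icc hj),
      intervalIntegral.integral_of_le (segment_lt n j).le, integral_Ioc_eq_integral_Ioo,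
      intervalIntegral.integral_of_le (segment_lt n j).le, integral_Ioc_eq_integral_Ioo]
    refine setIntegral_congr_fun measurableSet_Ioo fun x hx => ?_
    simp [hPt x (Ioo_subset_Ico_self hx)]
  rw [norm_sq_eq_integral,
    integral_eq_sum_segments (n := n) (intervalIntegrable_sq_coe _ (by simp) (by simp))]
  refine le_trans (le_of_eq ?_) (Finset.sum_le_sum hseg)
  rw [Finset.sum_const, Finset.card_range, nsmul_eq_mul, pow_succ _ (2 * (p + 1))]
  field_simp

end Legendre

/-! ### Comparison of the explicit constants -/

/-- The bound `(1 / (m π)) ^ (2 (p + 1))` for smooth splines on `m = (n - 1) p + 1` segments lies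
below the bound for continuous splines on `n` segments, with the denominators cleared. -/
def ConstantsCompare (p n m : ℕ) : Prop :=
  (n : ℝ) ^ (2 * (p + 1)) * ((2 * (p + 1)).factorial * (2 * (p + 1) + 1).factorial)
    < ((p + 1).factorial : ℝ) ^ 2 * (m * Real.pi) ^ (2 * (p + 1))

/-- If `n / m ≤ n₀ / m₀`, the comparison for `(n₀, m₀)` implies the one for `(n, m)`. -/
theorem ConstantsCompare.mono {p n₀ n m₀ m : ℕ} (hm₀ : 0 < m₀) (hm0 : 0 < m) (hle : n * m₀ ≤ n₀ * m)
    (h : ConstantsCompare p n₀ m₀) : ConstantsCompare p n m := by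
  have hm : (0 : ℝ) < m₀ := by exact_mod_cast hm₀
  unfold ConstantsCompare at h ⊢
  set F : ℝ := ((2 * (p + 1)).factorial * (2 * (p + 1) + 1).factorial) with hF
  have hF0 : 0 < F := by positivity
  have hle' : (n : ℝ) * m₀ ≤ n₀ * m := by exact_mod_cast hle
  have hmp : (0 : ℝ) < m := by exact_mod_cast hm0
  refine lt_of_mul_lt_mul_right ?_ (pow_nonneg hm.le (2 * (p + 1)))
  calc (n : ℝ) ^ (2 * (p + 1)) * F * m₀ ^ (2 * (p + 1)) = (n * m₀) ^ (2 * (p + 1)) * F := by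
        rw [mul_pow]; ring
    _ ≤ (n₀ * m) ^ (2 * (p + 1)) * F := by gcongr
    _ = (n₀ : ℝ) ^ (2 * (p + 1)) * F * m ^ (2 * (p + 1)) := by rw [mul_pow]; ring
    _ < ((p + 1).factorial : ℝ) ^ 2 * (m₀ * Real.pi) ^ (2 * (p + 1)) * m ^ (2 * (p + 1)) := by
        gcongr
    _ = _ := by simp only [mul_pow]; ring

/-- It suffices to compare with a lower approximation `q` of `π`. -/
theorem constantsCompare_of_pi {p n m : ℕ} {q : ℝ} (hq0 : 0 ≤ q) (hq : q ≤ Real.pi)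
    (h : (n : ℝ) ^ (2 * (p + 1)) * ((2 * (p + 1)).factorial * (2 * (p + 1) + 1).factorial)
    < ((p + 1).factorial : ℝ) ^ 2 * (m * q) ^ (2 * (p + 1))) : ConstantsCompare p n m :=
  h.trans_le (by gcongr)

theorem constantsCompare_three : ConstantsCompare 3 7 19 := by
  refine constantsCompare_of_pi (by norm_num) Real.pi_gt_d4.le ?_
  norm_num [Nat.factorial]

theorem constantsCompare_four : ConstantsCompare 4 4 13 := by
  refine constantsCompare_of_pi (by norm_num) Real.pi_gt_d4.le ?_
  norm_num [Nat.factorial]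

theorem constantsCompare_five : ConstantsCompare 5 4 16 := by
  refine constantsCompare_of_pi (by norm_num) Real.pi_gt_d4.le ?_
  norm_num [Nat.factorial]

theorem exp_le_one_add_pow {x : ℝ} (hx : 0 ≤ x) (r : ℕ) :
    Real.exp (r * (2 * x / (x + 2))) ≤ (1 + x) ^ r := by
  rw [Real.exp_nat_mul]
  gcongr
  exact (Real.le_log_iff_exp_le (by positivity)).1 (Real.le_log_one_add_of_nonneg hx)

theorem factorials_succ (p : ℕ) :
    ((2 * (p + 1 + 1)).factorial * (2 * (p + 1 + 1) + 1).factorial : ℝ)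
      = ((2 * (p + 1)).factorial * (2 * (p + 1) + 1).factorial)
        * ((2 * p + 3) * (2 * p + 4) ^ 2 * (2 * p + 5)) := by
  have h1 : 2 * (p + 1 + 1) = 2 * (p + 1) + 1 + 1 := by ring
  rw [h1, Nat.factorial_succ (2 * (p + 1) + 1 + 1), Nat.factorial_succ (2 * (p + 1) + 1),
    Nat.factorial_succ (2 * (p + 1))]
  push_cast
  ring

/-- Passing from `p` to `p + 1` multiplies the two sides of the comparison by explicit factors. -/
theorem constantsCompare_step {p n m m' : ℕ} (h : ConstantsCompare p n m)
    (hstep : (n : ℝ) ^ 2 * ((2 * p + 3) * (2 * p + 4) ^ 2 * (2 * p + 5)) * m ^ (2 * (p + 1))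
      ≤ (p + 2) ^ 2 * Real.pi ^ 2 * m' ^ 2 * m' ^ (2 * (p + 1))) (hn : 0 < n) (hm : 0 < m) :
    ConstantsCompare (p + 1) n m' := by
  have hm : (0 : ℝ) < m := by exact_mod_cast hm
  unfold ConstantsCompare at h ⊢
  rw [factorials_succ]
  set F : ℝ := ((2 * (p + 1)).factorial * (2 * (p + 1) + 1).factorial) with hF
  refine lt_of_mul_lt_mul_right ?_ (pow_nonneg hm.le (2 * (p + 1)))
  have hn' : (0 : ℝ) < n := by exact_mod_cast hn
  calc (n : ℝ) ^ (2 * (p + 1 + 1)) * (F * ((2 * p + 3) * (2 * p + 4) ^ 2 * (2 * p + 5)))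
        * m ^ (2 * (p + 1))
      = (n : ℝ) ^ (2 * (p + 1)) * F
        * (n ^ 2 * ((2 * p + 3) * (2 * p + 4) ^ 2 * (2 * p + 5)) * m ^ (2 * (p + 1))) := by ring
    _ < ((p + 1).factorial : ℝ) ^ 2 * (m * Real.pi) ^ (2 * (p + 1))
        * (n ^ 2 * ((2 * p + 3) * (2 * p + 4) ^ 2 * (2 * p + 5)) * m ^ (2 * (p + 1))) := by
        gcongr
    _ ≤ ((p + 1).factorial : ℝ) ^ 2 * (m * Real.pi) ^ (2 * (p + 1))
        * ((p + 2) ^ 2 * Real.pi ^ 2 * m' ^ 2 * m' ^ (2 * (p + 1))) := by gcongr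
    _ = _ := by
        rw [Nat.factorial_succ (p + 1)]
        push_cast
        ring

theorem constantsCompare_of_six_le {p : ℕ} (hp : 6 ≤ p) : ConstantsCompare p 3 (2 * p + 1) := by
  induction p, hp using Nat.le_induction with
  | base =>
    refine constantsCompare_of_pi (by norm_num) Real.pi_gt_d4.le ?_
    norm_num [Nat.factorial]
  | succ p hp ih =>
    refine constantsCompare_step ih ?_ (by norm_num) (by omega)
    have hp' : (6 : ℝ) ≤ p := by exact_mod_cast hp
    have hm : (0 : ℝ) < 2 * p + 1 := by positivity
    -- `(1 + 2 / (2 p + 1)) ^ (p + 1) ≥ e`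
    have h1 := exp_le_one_add_pow (x := 2 / (2 * p + 1)) (by positivity) (p + 1)
    have h2 : ((p + 1 : ℕ) : ℝ) * (2 * (2 / (2 * p + 1)) / (2 / (2 * p + 1) + 2)) = 1 := by
      push_cast
      field_simp
      ring
    have h3 : (1 : ℝ) + 2 / (2 * p + 1) = (2 * p + 3) / (2 * p + 1) := by field_simp; ring
    rw [h2, h3, div_pow, le_div_iff₀ (by positivity)] at h1
    have he : (2.7 : ℝ) ≤ Real.exp 1 := by linarith [Real.exp_one_gt_d9]
    have h4 : (2.7 : ℝ) * (2 * p + 1) ^ (p + 1) ≤ (2 * p + 3) ^ (p + 1) :=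
      le_trans (by gcongr) h1
    have h5 : 7.29 * ((2 * p + 1 : ℝ) ^ (p + 1)) ^ 2 ≤ ((2 * p + 3) ^ (p + 1)) ^ 2 := by
      have := pow_le_pow_left₀ (by positivity) h4 2
      rw [mul_pow] at this
      norm_num at this ⊢
      exact this
    have hπ : (9 : ℝ) ≤ Real.pi ^ 2 := by nlinarith [Real.pi_gt_three]
    push_cast
    rw [mul_comm 2 (p + 1), pow_mul, pow_mul]
    calc (3 : ℝ) ^ 2 * ((2 * p + 3) * (2 * p + 4) ^ 2 * (2 * p + 5)) * ((2 * p + 1) ^ (p + 1)) ^ 2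
        ≤ ((p + 2) ^ 2 * 9 * (2 * p + 3) ^ 2) * (7.29 * ((2 * p + 1) ^ (p + 1)) ^ 2) := by
          rw [← mul_assoc _ (7.29 : ℝ)]
          gcongr ?_ * _
          have h6 : (4 : ℝ) * (2 * p + 5) ≤ 7.29 * (2 * p + 3) := by linarith
          have h7 : (0 : ℝ) ≤ 9 * ((p + 2) ^ 2 * (2 * p + 3)) := by positivity
          linarith [mul_le_mul_of_nonneg_left h6 h7]
      _ ≤ ((p + 2) ^ 2 * Real.pi ^ 2 * (2 * p + 3) ^ 2) * ((2 * p + 3) ^ (p + 1)) ^ 2 := by gcongr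
      _ = _ := by ring

theorem constantsCompare_of_thirtyeight_le {p : ℕ} (hp : 38 ≤ p) :
    ConstantsCompare p 2 (p + 1) := by
  induction p, hp using Nat.le_induction with
  | base =>
    refine constantsCompare_of_pi (by norm_num) Real.pi_gt_d4.le ?_
    norm_num [Nat.factorial]
  | succ p hp ih =>
    refine constantsCompare_step ih ?_ (by norm_num) (by omega)
    have hp' : (38 : ℝ) ≤ p := by exact_mod_cast hp
    -- `(1 + 1 / (p + 1)) ^ (p + 1) ≥ e ^ (1 - 1 / 79)`, which exceeds `8 / π`
    have h1 := exp_le_one_add_pow (x := 1 / (p + 1)) (by positivity) (p + 1)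
    have h2 : (1 : ℝ) + (-1 / 79) ≤
        ((p + 1 : ℕ) : ℝ) * (2 * (1 / (p + 1)) / (1 / (p + 1) + 2)) := by
      have : ((p + 1 : ℕ) : ℝ) * (2 * (1 / (p + 1)) / (1 / (p + 1) + 2))
          = (2 * p + 2) / (2 * p + 3) := by
        push_cast
        field_simp
        ring
      rw [this, le_div_iff₀ (by positivity)]
      linarith
    have h3 : (1 : ℝ) + 1 / (p + 1) = (p + 2) / (p + 1) := by field_simp; ring
    have he : (2.6 : ℝ) ≤ Real.exp (1 + (-1 / 79)) := by
      rw [Real.exp_add]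
      have ha := Real.exp_one_gt_d9
      have hb := Real.add_one_le_exp (-1 / 79 : ℝ)
      nlinarith
    rw [h3, div_pow] at h1
    have h4 : (2.6 : ℝ) * (p + 1) ^ (p + 1) ≤ (p + 2) ^ (p + 1) :=
      (le_div_iff₀ (by positivity)).1 (he.trans ((Real.exp_le_exp.2 h2).trans h1))
    have h5 : 6.76 * ((p + 1 : ℝ) ^ (p + 1)) ^ 2 ≤ ((p + 2) ^ (p + 1)) ^ 2 := by
      have := pow_le_pow_left₀ (by positivity) h4 2
      rw [mul_pow] at this
      norm_num at this ⊢
      exact this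
    have hπ : (9.8 : ℝ) ≤ Real.pi ^ 2 := by nlinarith [Real.pi_gt_d4]
    push_cast
    rw [mul_comm 2 (p + 1), pow_mul, pow_mul, add_assoc (p : ℝ) 1 1, one_add_one_eq_two]
    calc (2 : ℝ) ^ 2 * ((2 * p + 3) * (2 * p + 4) ^ 2 * (2 * p + 5)) * ((p + 1) ^ (p + 1)) ^ 2
        ≤ ((p + 2) ^ 2 * 9.8 * (p + 2) ^ 2) * (6.76 * ((p + 1) ^ (p + 1)) ^ 2) := by
          rw [← mul_assoc _ (6.76 : ℝ)]
          gcongr ?_ * _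
          have h6 : (16 : ℝ) * ((2 * p + 3) * (2 * p + 5)) ≤ 9.8 * 6.76 * (p + 2) ^ 2 := by nlinarith
          linarith [mul_le_mul_of_nonneg_left h6 (sq_nonneg (p + 2 : ℝ))]
      _ ≤ ((p + 2) ^ 2 * Real.pi ^ 2 * (p + 2) ^ 2) * ((p + 2) ^ (p + 1)) ^ 2 := by gcongr
      _ = _ := by ring

theorem constantsCompare {p n m : ℕ} (hm : m = (n - 1) * p + 1)
    (h : (p = 3 ∧ 7 ≤ n) ∨ ((p = 4 ∨ p = 5) ∧ 4 ≤ n) ∨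
      ((6 ≤ p ∧ p ≤ 37) ∧ 3 ≤ n) ∨ (38 ≤ p ∧ 2 ≤ n)) : ConstantsCompare p n m := by
  have hle : ∀ n₀, 1 ≤ n₀ → n₀ ≤ n → 1 ≤ p → n * ((n₀ - 1) * p + 1) ≤ n₀ * m := by
    rintro n₀ hn₀ hn hp
    obtain ⟨a, rfl⟩ := Nat.exists_eq_add_of_le' hn₀
    obtain ⟨b, rfl⟩ := Nat.exists_eq_add_of_le hn
    obtain ⟨q, rfl⟩ := Nat.exists_eq_add_of_le' hp
    rw [hm, show a + 1 + b - 1 = a + b by omega, Nat.add_sub_cancel]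
    nlinarith [Nat.zero_le (b * q)]
  rcases h with ⟨rfl, hn⟩ | ⟨rfl | rfl, hn⟩ | ⟨⟨hp, -⟩, hn⟩ | ⟨hp, hn⟩
  · exact constantsCompare_three.mono (by norm_num) (by omega) (hle 7 (by norm_num) hn (by norm_num))
  · exact constantsCompare_four.mono (by norm_num) (by omega) (hle 4 (by norm_num) hn (by norm_num))
  · exact constantsCompare_five.mono (by norm_num) (by omega) (hle 4 (by norm_num) hn (by norm_num))
  · exact (constantsCompare_of_six_le hp).mono (by omega) (by omega) (hle 3 (by norm_num) hn (by omega))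
  · refine (constantsCompare_of_thirtyeight_le hp).mono (by omega) (by omega) ?_
    simpa using hle 2 (by norm_num) hn (by omega)

/-! ### The approximation constants -/

theorem splineSpace_maxSmooth_eq_smoothSpace (p n : ℕ) [NeZero n] :
    splineSpace (p + 1) p n = smoothSpace n (p + 1) := by
  induction p with
  | zero => exact splineSpace_zero_eq_primitives 0 n
  | succ p ih => rw [splineSpace_succ_eq_primitives, ih]; rfl

theorem splineSpace_anti {p k l n : ℕ} (h : k ≤ l) : splineSpace p l n ≤ splineSpace p k n := by
  rintro u ⟨s, ⟨hs, hs'⟩, hu⟩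
  exact ⟨s, ⟨hs.of_le (by exact_mod_cast h), hs'⟩, hu⟩

theorem splineSpace_le_brokenSpace (p k n : ℕ) : splineSpace p k n ≤ brokenSpace p n := by
  rintro u ⟨s, ⟨-, hs⟩, hu⟩
  exact ⟨s, hs, hu⟩

/-- The upper bound for maximally smooth splines of degree `p + 1`: here `(1 / (n π)) ^ (p + 2)`. -/
theorem mem_errorBounds_maxSmooth (p n : ℕ) [NeZero n] :
    (1 / (n * Real.pi)) ^ (p + 2) ∈ errorBounds (p + 1) p n (p + 1) := by
  intro f hf g hg
  refine (norm_sub_starProjection_le f ?_).trans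
    (sub_starProjection_smoothSpace_le (isPrimitive_of_mem_sobolev hf hg))
  rw [splineSpace_maxSmooth_eq_smoothSpace]
  exact Submodule.starProjection_apply_mem _ _

/-- Smooth splines are continuous, so the bound for them also serves the larger space. -/
theorem mem_errorBounds_continuous (p n : ℕ) [NeZero n] :
    (1 / (n * Real.pi)) ^ (p + 2) ∈ errorBounds (p + 1) 0 n (p + 1) := fun f hf g hg =>
  (norm_sub_starProjection_le f
    (splineSpace_anti (Nat.zero_le p) ((splineSpace (p + 1) p n).starProjection_apply_mem f))).trans
    (mem_errorBounds_maxSmooth p n f hf g hg)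

/-- The test function `x ^ (p + 1)`, whose derivative of order `p + 1` is constant. -/
theorem exists_monomial (p : ℕ) : ∃ f ∈ sobolev (p + 1), ∃ g : L2, IsWeakDeriv (p + 1) f g ∧
    ‖g‖ = (p + 1).factorial ∧ f =ᵐ[unitMeasure] fun x => x ^ (p + 1) := by
  have hf := (memLp_polynomial (Polynomial.X ^ (p + 1))).coeFn_toLp
  refine ⟨(memLp_polynomial (Polynomial.X ^ (p + 1))).toLp,
    fun j _ => ⟨(memLp_polynomial (Polynomial.derivative^[j] (Polynomial.X ^ (p + 1)))).toLp,
      isWeakDeriv_polynomial _ j hf (MemLp.coeFn_toLp _)⟩, ((p + 1).factorial : ℝ) • one,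
    isWeakDeriv_polynomial _ _ hf ?_, ?_, by simpa using hf⟩
  · rw [Polynomial.iterate_derivative_X_pow_eq_C_mul]
    filter_upwards [Lp.coeFn_smul ((p + 1).factorial : ℝ) one, coeFn_one] with x h1 h2
    rw [h1, Pi.smul_apply, h2, Nat.descFactorial_self]
    simp
  · have h1 : ‖one‖ = 1 := by
      have := inner_one_one
      rw [real_inner_self_eq_norm_sq] at this
      exact (pow_eq_one_iff_of_nonneg (norm_nonneg _) two_ne_zero).1 this
    rw [norm_smul, h1, mul_one, Real.norm_of_nonneg (by positivity)]

theorem nonneg_of_mem_errorBounds {p k n q : ℕ} [NeZero n] {c : ℝ} (hc : c ∈ errorBounds p k n q) :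
    0 ≤ c := by
  obtain ⟨f, hf, g, hg, hgn, -⟩ := exists_monomial q
  have h := (norm_nonneg _).trans (hc f hf g hg)
  rw [hgn] at h
  exact nonneg_of_mul_nonneg_left h (by positivity)

theorem isLeast_approxConst {p k n : ℕ} [NeZero n] (h : (errorBounds p k n p).Nonempty) :
    IsLeast (errorBounds p k n p) (approxConst p k n) := by
  have hbdd : BddBelow (errorBounds p k n p) := ⟨0, fun c hc => nonneg_of_mem_errorBounds hc⟩
  have hclosed : IsClosed (errorBounds p k n p) := by
    simp only [errorBounds, ofPred_forall]
    refine isClosed_iInter fun f => isClosed_iInter fun _ => isClosed_iInter fun g =>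
      isClosed_iInter fun _ => isClosed_le continuous_const (by fun_prop)
  exact ⟨hclosed.csInf_mem h hbdd, fun c hc => csInf_le hbdd hc⟩

/-- Testing the error estimate with `x ^ (p + 1)`. -/
theorem le_sq_of_mem_errorBounds {p k n : ℕ} [NeZero n] {c : ℝ} (hc : c ∈ errorBounds p k n p) :
    (1 / (n : ℝ)) ^ (2 * (p + 1)) * (((p + 1).factorial : ℝ) ^ 2
      / ((2 * (p + 1)).factorial * (2 * (p + 1) + 1).factorial)) ≤ c ^ 2 := by
  obtain ⟨f, hf, g, hg, hgn, hfx⟩ := exists_monomial p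
  have h1 := le_norm_sub_sq hfx (splineSpace_le_brokenSpace p k n
    ((splineSpace p k n).starProjection_apply_mem f))
  have h2 := pow_le_pow_left₀ (norm_nonneg _) (hc f hf g hg) 2
  rw [hgn, mul_pow] at h2
  have hF : (0 : ℝ) < ((p + 1).factorial : ℝ) ^ 2 := by positivity
  refine le_of_mul_le_mul_right ?_ hF
  refine le_trans (le_of_eq ?_) (h1.trans h2)
  ring

end SplineApprox

open SplineApprox in
theorem mainTheorem3 (p n m : ℕ) [NeZero n] [NeZero m]
    (hm : m = (n - 1) * p + 1)
    (h : (p = 3 ∧ 7 ≤ n) ∨ ((p = 4 ∨ p = 5) ∧ 4 ≤ n) ∨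
      ((6 ≤ p ∧ p ≤ 37) ∧ 3 ≤ n) ∨ (38 ≤ p ∧ 2 ≤ n)) :
    Module.finrank ℝ (splineSpace p (p - 1) m) = n * p + 1 ∧
    Module.finrank ℝ (splineSpace p 0 n) = n * p + 1 ∧
    IsLeast (errorBounds p (p - 1) m p) (approxConst p (p - 1) m) ∧
    IsLeast (errorBounds p 0 n p) (approxConst p 0 n) ∧
    approxConst p (p - 1) m < approxConst p 0 n := by
  have hcmp := constantsCompare hm h
  obtain ⟨p, rfl⟩ : ∃ q, p = q + 1 := ⟨p - 1, by omega⟩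
  obtain ⟨l, rfl⟩ : ∃ l, n = l + 1 := ⟨n - 1, by omega⟩
  have hsmooth : IsLeast (errorBounds (p + 1) p m (p + 1)) (approxConst (p + 1) p m) :=
    isLeast_approxConst ⟨_, mem_errorBounds_maxSmooth p m⟩
  have hcont : IsLeast (errorBounds (p + 1) 0 (l + 1) (p + 1)) (approxConst (p + 1) 0 (l + 1)) :=
    isLeast_approxConst ⟨_, mem_errorBounds_continuous p (l + 1)⟩
  refine ⟨?_, ?_, hsmooth, hcont, ?_⟩
  · rw [Nat.add_sub_cancel, splineSpace_maxSmooth_eq_smoothSpace, finrank_smoothSpace, hm,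
      Nat.add_sub_cancel]
    ring
  · rw [splineSpace_zero_eq_primitives, finrank_primitives, finrank_brokenSpace]
  · refine (hsmooth.2 (mem_errorBounds_maxSmooth p m)).trans_lt ?_
    refine lt_of_pow_lt_pow_left₀ 2 (nonneg_of_mem_errorBounds hcont.1)
      (lt_of_lt_of_le ?_ (le_sq_of_mem_errorBounds hcont.1))
    have hm0 : (0 : ℝ) < m := Nat.cast_pos.2 (NeZero.pos m)
    have hn0 : (0 : ℝ) < (l + 1 : ℕ) := Nat.cast_pos.2 (NeZero.pos _)
    have hπ := Real.pi_pos
    unfold ConstantsCompare at hcmp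
    rw [← pow_mul, mul_comm (p + 2) 2, one_div_pow, one_div_pow, div_mul_div_comm, one_mul,
      div_lt_div_iff₀ (by positivity) (by positivity), one_mul]
    exact hcmp
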